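/- All graphs are finite and simple. The \emph{dappled triangular grid} $\mathbf T$ is the infinite graph with vertex set $\mathbb Z^2$ in which $x$ and $y$ are adjacent iff $y-x\in\{\pm(1,0),\pm(0,1),\pm(1,1)\}$; its vertex $(i,j)$ has hue $(i+j)\bmod 3\in\mathbb Z_3$ and color $(i\bmod 2,j\bmod 2)\in\mathbb Z_2^2$. A \emph{hued graph} is a graph with a fixed proper coloring of its vertices by hues from $\mathbb Z_3$; a \emph{4-coloring} is a proper coloring by elements of $\mathbb Z_2^2$. A 4-coloring $\varphi$ of a connected hued graph $C$ is \emph{viable} if there is a graph homomorphism from $C$ to $\mathbf T$ preserving hues and colors (where $\varphi$ gives the colors of the vertices of $C$); such a homomorphism $f$ is unique up to a translation of $\mathbf T$ and is called a homomorphism corresponding to $\varphi$. A one-step retraction of a walk replaces a segment $x,y,x$ by $x$; the \emph{topological retract} of a walk is the (unique) walk obtained by performing one-step retractions as long as possible. One-step retractions of closed walks (cyclic sequences of vertices) are defined analogously, where the one-step retraction of a closed walk of length two is the empty walk. A closed walk is \emph{null-homotopic} if its topological retract is empty. A \emph{near-quadrangulation} is a $2$-connected plane graph $H$ all of whose internal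 faces have length four. Let $H$ be a near-quadrangulation with the outer face bounded by a cycle $C$, whose vertices are given hues $0$ and $1$ according to a bipartition of $H$. The \emph{patch extension} $G$ of $H$ is the hued graph obtained from $H$ by adding to each face other than the outer one a new vertex of hue $2$ adjacent to all vertices on the boundary of the face. Let $\varphi$ be a viable 4-coloring of the cycle $C$, and let $f$ be a homomorphism from $C$ to $\mathbf T$ corresponding to $\varphi$. We say that $\varphi$ is \emph{null-homotopic on $C$} if the closed walk $f(C)$ is null-homotopic. A \emph{generalized chord} of $C$ with \emph{base} $B$ is a path $P$ in $H$ that intersects $C$ exactly in the two ends of $P$, together with a subpath $B$ of $C$ with the same ends as $P$. A \emph{$\varphi$-shortcut} is a generalized chord $P$ of $C$ with base $B$ such that the topological retract of $f(B)$ has more edges than $P$. Then $\varphi$ extends to a 4-coloring of $G$ if and only if $\varphi$ is null-homotopic on $C$ and $H$ has no $\varphi$-shortcuts. -/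

import Mathlib

/-! ### Plane graphs

A plane drawing of a finite connected graph on the sphere is given, up to homeomorphism, by its
rotation system: the cyclic order of the half-edges (darts) around each vertex.  Faces are the
orbits of the face-tracing permutation, and the rotation system describes a drawing on the sphere
exactly when Euler's formula holds.  A plane graph is obtained by choosing the outer face. -/

/-- A rotation system of the graph `H`. -/
structure RotationSystem {V : Type*} (H : SimpleGraph V) where
  /-- The next dart in the cyclic order around the initial vertex. -/
  rot : Equiv.Perm H.Dart
  rot_fst : ∀ d, (rot d).fst = d.fst
  /-- The darts leaving a vertex form a single cycle of the rotation. -/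
  rot_sameCycle : ∀ d d' : H.Dart, d.fst = d'.fst → rot.SameCycle d d'

namespace RotationSystem

variable {V : Type*} {H : SimpleGraph V} (E : RotationSystem H)

/-- Face tracing: traverse a dart from `u` to `v`, then continue with the dart which
follows the reversed dart (from `v` to `u`) in the rotation at `v`. -/
def facePerm : Equiv.Perm H.Dart :=
  (SimpleGraph.Dart.symm_involutive (G := H)).toPerm.trans E.rot

/-- The faces are the orbits of the face-tracing permutation. -/
def Face : Type _ := Quotient (Equiv.Perm.SameCycle.setoid E.facePerm)

/-- The face whose boundary walk traverses the dart `d`. -/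
def faceOf (d : H.Dart) : E.Face := Quotient.mk (Equiv.Perm.SameCycle.setoid E.facePerm) d

variable {E}

/-- The length of the boundary walk of a face. -/
noncomputable def Face.length (p : E.Face) : ℕ := Nat.card {d : H.Dart // E.faceOf d = p}

/-- The vertex `v` lies on the boundary of the face `p`. -/
def Face.HasVertex (p : E.Face) (v : V) : Prop := ∃ d : H.Dart, E.faceOf d = p ∧ d.fst = v

/-- The face `p` is bounded by the cycle `C`: the edges of `C` are exactly the edges on the
boundary of `p`. -/
def Face.BoundedBy (p : E.Face) {c : V} (C : H.Walk c c) : Prop :=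
  C.IsCycle ∧ ∀ e : Sym2 V, e ∈ C.edges ↔ ∃ d : H.Dart, E.faceOf d = p ∧ d.edge = e

end RotationSystem

/-- A plane embedding of a connected graph (with at least one edge): a rotation system which
satisfies Euler's formula `|V| - |E| + |F| = 2`. -/
structure PlaneEmbedding {V : Type*} (H : SimpleGraph V) extends RotationSystem H where
  connected : H.Connected
  euler : (Nat.card V : ℤ) - Nat.card H.edgeSet + Nat.card toRotationSystem.Face = 2

/-- The faces of a plane embedding. -/
abbrev PlaneEmbedding.Face {V : Type*} {H : SimpleGraph V} (E : PlaneEmbedding H) : Type _ :=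
  E.toRotationSystem.Face

/-- A graph is 2-connected if it has at least three vertices and it is connected and stays
connected after deleting any single vertex. -/
def IsTwoConnected {V : Type*} (H : SimpleGraph V) : Prop :=
  3 ≤ Nat.card V ∧ H.Connected ∧ ∀ v : V, (H.induce {v}ᶜ).Connected

/-- A near-quadrangulation: a 2-connected plane graph (with the given outer face) all of whose
internal faces have length four. -/
def IsNearQuadrangulation {V : Type*} (H : SimpleGraph V) (E : PlaneEmbedding H)
    (outer : E.Face) : Prop :=
  IsTwoConnected H ∧ ∀ p : E.Face, p ≠ outer → p.length = 4

/-! ### Hued and dappled graphs -/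

/-- The four colors. -/
abbrev Color : Type := ZMod 2 × ZMod 2

/-- A hued graph: a graph with a fixed proper 3-coloring. -/
structure HuedGraph (V : Type*) where
  graph : SimpleGraph V
  hue : graph.Coloring (ZMod 3)

/-- A dappled graph: a hued graph with, in addition, a fixed proper 4-coloring. -/
structure DappledGraph (V : Type*) extends HuedGraph V where
  color : graph.Coloring Color

/-- Homomorphisms of dappled graphs preserve edges, hues and colors. -/
structure DappledGraph.Hom {V W : Type*} (G : DappledGraph V) (G' : DappledGraph W) where
  toHom : G.graph →g G'.graph
  hue_eq : ∀ v, G'.hue (toHom v) = G.hue v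
  color_eq : ∀ v, G'.color (toHom v) = G.color v

/-- The dappled graph obtained from a hued graph and a 4-coloring of it. -/
def HuedGraph.dapple {V : Type*} (G : HuedGraph V) (θ : G.graph.Coloring Color) :
    DappledGraph V where
  toHuedGraph := G
  color := θ

/-- A subgraph of a hued graph, as a hued graph. -/
abbrev HuedGraph.sub {V : Type*} (G : HuedGraph V) (S : G.graph.Subgraph) :
    HuedGraph S.verts where
  graph := S.coe
  hue := G.hue.comp S.hom

/-- Two points of `ℤ × ℤ` are adjacent in the triangular grid if they differ by
`±(1,0)`, `±(0,1)` or `±(1,1)`. -/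
def gridAdj (x y : ℤ × ℤ) : Prop :=
  y - x = (1, 0) ∨ y - x = (-1, 0) ∨ y - x = (0, 1) ∨ y - x = (0, -1) ∨
    y - x = (1, 1) ∨ y - x = (-1, -1)

/-- The dappled triangular grid. -/
def triangularGrid : DappledGraph (ℤ × ℤ) where
  graph :=
    { Adj := gridAdj
      symm := ⟨by
        rintro ⟨a, b⟩ ⟨c, d⟩ h
        simp only [gridAdj, Prod.mk_sub_mk, Prod.mk.injEq] at h ⊢
        omega⟩
      loopless := ⟨by
        rintro ⟨a, b⟩ h
        simp [gridAdj, Prod.ext_iff] at h⟩ }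
  hue := SimpleGraph.Coloring.mk (fun x => ((x.1 + x.2 : ℤ) : ZMod 3)) (by
    rintro ⟨a, b⟩ ⟨c, d⟩ h e
    have e' := (ZMod.intCast_eq_intCast_iff_dvd_sub _ _ 3).1 e
    simp only [gridAdj, Prod.mk_sub_mk, Prod.mk.injEq] at h
    simp only [Nat.cast_ofNat] at e'
    omega)
  color := SimpleGraph.Coloring.mk (fun x => ((x.1 : ZMod 2), (x.2 : ZMod 2))) (by
    rintro ⟨a, b⟩ ⟨c, d⟩ h e
    have e1 := (ZMod.intCast_eq_intCast_iff_dvd_sub _ _ 2).1 (congrArg Prod.fst e)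
    have e2 := (ZMod.intCast_eq_intCast_iff_dvd_sub _ _ 2).1 (congrArg Prod.snd e)
    simp only [gridAdj, Prod.mk_sub_mk, Prod.mk.injEq] at h
    simp only [Nat.cast_ofNat] at e1 e2
    omega)

/-- A 4-coloring of a hued graph is viable if the resulting dappled graph has a homomorphism to
the dappled triangular grid. -/
def Viable {V : Type*} (G : HuedGraph V) (θ : G.graph.Coloring Color) : Prop :=
  Nonempty ((G.dapple θ).Hom triangularGrid)

/-! ### The patch extension -/

/-- All the hues are `0` or `1` (so the hues give a bipartition of the graph). -/
def HuedGraph.UsesHuesZeroOne {V : Type*} (H : HuedGraph V) : Prop :=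
  ∀ v, H.hue v = 0 ∨ H.hue v = 1

/-- Adjacency in the patch extension, see `patchExtension`. -/
def patchAdj {V : Type*} {H : SimpleGraph V} {E : PlaneEmbedding H} (outer : E.Face) :
    V ⊕ {p : E.Face // p ≠ outer} → V ⊕ {p : E.Face // p ≠ outer} → Prop
  | .inl u, .inl v => H.Adj u v
  | .inl u, .inr p => p.1.HasVertex u
  | .inr p, .inl u => p.1.HasVertex u
  | .inr _, .inr _ => False

/-- The patch extension of a bipartite plane graph whose vertices have hues `0` and `1`: in each
face except for the outer one, a new vertex of hue `2` is added and joined with all vertices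
on the boundary of the face. -/
def patchExtension {V : Type*} (H : HuedGraph V) (hH : H.UsesHuesZeroOne)
    {E : PlaneEmbedding H.graph} (outer : E.Face) :
    HuedGraph (V ⊕ {p : E.Face // p ≠ outer}) where
  graph :=
    { Adj := patchAdj outer
      symm := ⟨by
        rintro (u | p) (v | q) h
        · exact H.graph.adj_symm h
        · exact h
        · exact h
        · exact h⟩
      loopless := ⟨by
        rintro (u | p) h
        · exact H.graph.irrefl h
        · exact h⟩ }
  hue := SimpleGraph.Coloring.mk (Sum.elim (fun v => H.hue v) (fun _ => 2)) (by
    have key : ∀ v, H.hue v ≠ 2 := by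
      intro v
      rcases hH v with h | h <;> rw [h] <;> decide
    rintro (u | p) (v | q) h
    · exact H.hue.valid h
    · exact key u
    · exact (key v).symm
    · exact h.elim)

/-! ### Homotopy -/

/-- One-step retraction of a walk: a segment `x y x` is replaced by `x`. -/
inductive RetractStep {V : Type*} {G : SimpleGraph V} {u v : V} :
    G.Walk u v → G.Walk u v → Prop
  | mk {x y : V} (p : G.Walk u x) (h : G.Adj x y) (h' : G.Adj y x) (q : G.Walk x v) :
      RetractStep (p.append (.cons h (.cons h' q))) (p.append q)

/-- `R` is the topological retract of the walk `W`: it is obtained by performing one-step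
retractions as long as possible. -/
def IsTopologicalRetract {V : Type*} {G : SimpleGraph V} {u v : V} (W R : G.Walk u v) : Prop :=
  Relation.ReflTransGen RetractStep W R ∧ ∀ R', ¬ RetractStep R R'

/-- One-step retraction of a closed walk, viewed as the cyclic sequence of its vertices.  The
one-step retraction of a closed walk of length two is the empty walk. -/
inductive CyclicRetractStep {V : Type*} : Cycle V → Cycle V → Prop
  | mk (x y : V) (l : List V) :
      CyclicRetractStep (↑(x :: y :: x :: l) : Cycle V) (↑(x :: l) : Cycle V)
  | two (x y : V) : CyclicRetractStep (↑[x, y] : Cycle V) Cycle.nil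

/-- The cyclic sequence of vertices of a closed walk (the repeated base vertex counted once). -/
def cyclicSequence {V : Type*} {G : SimpleGraph V} {u : V} (W : G.Walk u u) : Cycle V :=
  (W.support.tail : Cycle V)

/-- A closed walk is null-homotopic if its topological retract is empty. -/
def IsNullHomotopic {V : Type*} {G : SimpleGraph V} {u : V} (W : G.Walk u u) : Prop :=
  Relation.ReflTransGen CyclicRetractStep (cyclicSequence W) Cycle.nil

/-- The 4-coloring `φ` of the subgraph formed by the closed walk `Z` in a hued graph is
null-homotopic on `Z`: the image of `Z` is null-homotopic for the homomorphisms to the dappled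
triangular grid (they all give the same walk up to a translation). -/
def NullHomotopicOn {V : Type*} (G : HuedGraph V) {c : V} (Z : G.graph.Walk c c)
    (φ : (G.sub Z.toSubgraph).graph.Coloring Color) : Prop :=
  ∀ f : ((G.sub Z.toSubgraph).dapple φ).Hom triangularGrid,
    IsNullHomotopic (Z.mapToSubgraph.map f.toHom)

/-- The path `P` is a generalized chord of the cycle `C`: it intersects `C` exactly in its ends
(in particular it shares no edge with `C`). -/
def IsGeneralizedChord {V : Type*} {H : SimpleGraph V} {c : V} (C : H.Walk c c) {u v : V}
    (P : H.Walk u v) : Prop :=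
  P.IsPath ∧ u ≠ v ∧ (∀ x ∈ P.support, x ∈ C.support ↔ x = u ∨ x = v) ∧
    ∀ e ∈ P.edges, e ∉ C.edges

/-- The generalized chord `P` of `C` with base `B` (a subpath of `C` with the same ends) is a
`φ`-shortcut: for the homomorphism `f` corresponding to `φ`, the topological retract of `f(B)`
has more edges than `P`. -/
def IsShortcut {V : Type*} (H : HuedGraph V) {c : V} (C : H.graph.Walk c c)
    (φ : (H.sub C.toSubgraph).graph.Coloring Color) {u v : C.toSubgraph.verts}
    (P : H.graph.Walk (u : V) (v : V)) (B : (H.sub C.toSubgraph).graph.Walk u v) : Prop :=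
  IsGeneralizedChord C P ∧ B.IsPath ∧
    ∃ (f : ((H.sub C.toSubgraph).dapple φ).Hom triangularGrid)
      (R : triangularGrid.graph.Walk (f.toHom u) (f.toHom v)),
      IsTopologicalRetract (B.map f.toHom) R ∧ P.length < R.length

/-!
A 4-coloring of a graph with hues `0` and `1` puts on every edge a letter, namely the difference of
the colors of its ends. In the part of the triangular grid with hues `0` and `1`, which is a
hexagonal grid, a walk is determined by its first vertex and its word of letters, and a one-step
retraction deletes two equal consecutive letters. Hence homotopy of walks is described by the free
product of groups of order two generated by the letters, acting on the tree of reduced words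
(`ReducedWord`, `wordPerm`, `holonomy`): a closed walk is null-homotopic if and only if its word
acts trivially (`IsNullHomotopic.holonomy_eq_one`, `isNullHomotopic_of_holonomy_eq_one`), and the
topological retract of a walk has the length of its reduced word
(`isChain_colorWord_of_irreducible`).

A coloring of the near-quadrangulation extends to the patch extension if and only if each internal
face has two opposite vertices of the same color (`exists_patchExtension_coloring`,
`patchExtension_coloring_face`); then the word around the face acts trivially.

Suppose that such a coloring is given. Since the internal faces fill a disk, the action of the word
of a walk depends only on the ends of the walk (`PlaneEmbedding.exists_potential`). Hence `C` is
null-homotopic, and for a generalized chord `P` with base `B` the retract of `f(B)` has the length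
of the reduced word of `P`, which is at most the length of `P`. The statement about the disk is
derived from Euler's formula: the edges outside a spanning tree form a spanning tree of the dual
graph (`PlaneEmbedding.exists_dual_isTree`); if the action is normalized to be trivial on the first
tree, then the dual edges where it is nontrivial form a forest, and a leaf of it other than the
outer face is a face around which the action is nontrivial.

Conversely, if `C` is null-homotopic, then its coloring lifts to the tree of reduced words
(`exists_potential_of_isCycle`). As there is no shortcut, the lift does not increase distances
(`forall_path_of_generalizedChord`). A contraction into a tree extends to the whole graph, and this
can be done explicitly (`exists_extension_to_tree`). The letters along the edges of the tree turn
the extension into a coloring; a closed walk of length four in a tree goes through some vertex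
twice, so each internal face has two opposite vertices of the same color.
-/

/-! ### Forests -/

namespace SimpleGraph

variable {V : Type*}

/-- A finite forest with at least one edge has a leaf different from any prescribed vertex. -/
theorem IsAcyclic.exists_ne_existsUnique_adj {G : SimpleGraph V} [Finite V] (hG : G.IsAcyclic)
    {a b : V} (hab : G.Adj a b) (r : V) : ∃ v, v ≠ r ∧ ∃! w, G.Adj v w := by
  have : Nonempty V := ⟨r⟩
  obtain ⟨u, v, p, hp, hmax⟩ := Walk.exists_isPath_forall_isPath_length_le_length G
  have hnil : ¬ p.Nil := by
    intro h
    have h1 := hmax a b (Walk.cons hab Walk.nil) (by simp [hab.ne])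
    have h2 := Walk.length_eq_zero_iff.2 h
    simp at h1
    omega
  have hu : ∃! w, G.Adj u w := by
    refine ⟨_, p.adj_snd hnil, fun w hadj ↦ ?_⟩
    apply hG.eq_snd_of_adj_start hp hadj
    have : ¬(p.cons hadj.symm).IsPath := by grind [Walk.length_cons]
    grind [hp.cons]
  have hv : ∃! w, G.Adj v w := by
    refine ⟨_, p.adj_penultimate hnil |>.symm, fun w hadj ↦ ?_⟩
    apply hG.eq_penultimate_of_adj_end hp hadj
    have : ¬(p.concat hadj).IsPath := by grind [Walk.length_concat]
    grind [hp.concat]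
  have huv : u ≠ v := hp.nil_iff_eq.not.mp hnil
  by_cases h : u = r
  · exact ⟨v, fun h' => huv (h.trans h'.symm), hv⟩
  · exact ⟨u, h, hu⟩

/-- On a tree every group-valued function on the darts is a coboundary. -/
theorem IsTree.exists_potential {T : SimpleGraph V} (hT : T.IsTree) {Γ : Type*} [Group Γ]
    (l : V → V → Γ) (hl : ∀ u v, l v u = (l u v)⁻¹) :
    ∃ g : V → Γ, ∀ u v, T.Adj u v → l u v = (g u)⁻¹ * g v := by
  obtain ⟨r⟩ := hT.connected.nonempty
  choose p hp _ using fun v => hT.existsUnique_path r v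
  let g : V → Γ := fun v => ((p v).darts.map fun d => l d.fst d.snd).prod
  have key : ∀ u v (h : T.Adj u v), u ∈ (p v).support → l u v = (g u)⁻¹ * g v := by
    intro u v h hu
    have e := hT.isAcyclic.path_concat (hp u) (hp v) h hu
    simp [g, e, Walk.darts_concat]
  refine ⟨g, fun u v h => ?_⟩
  by_cases hu : u ∈ (p v).support
  · exact key u v h hu
  · have := key v u h.symm
      (hT.isAcyclic.mem_support_of_ne_mem_support_of_adj_of_isPath (hp u) (hp v) h hu)
    rw [hl, this]
    group

end SimpleGraph

/-! ### Faces of rotation systems -/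

namespace RotationSystem

variable {V : Type*} {H : SimpleGraph V} (E : RotationSystem H)

theorem facePerm_apply (d : H.Dart) : E.facePerm d = E.rot d.symm := rfl

theorem facePerm_fst (d : H.Dart) : (E.facePerm d).fst = d.snd := E.rot_fst _

theorem faceOf_eq_iff {d d' : H.Dart} :
    E.faceOf d = E.faceOf d' ↔ E.facePerm.SameCycle d d' := Quotient.eq

theorem faceOf_facePerm (d : H.Dart) : E.faceOf (E.facePerm d) = E.faceOf d :=
  E.faceOf_eq_iff.2 (Equiv.Perm.sameCycle_apply_left.2 (.refl _ _))

theorem facePerm_pow_succ_fst (d : H.Dart) (n : ℕ) :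
    ((E.facePerm ^ (n + 1)) d).fst = ((E.facePerm ^ n) d).snd := by
  rw [pow_succ', Equiv.Perm.mul_apply, facePerm_fst]

theorem faceOf_facePerm_pow (d : H.Dart) (n : ℕ) :
    E.faceOf ((E.facePerm ^ n) d) = E.faceOf d :=
  E.faceOf_eq_iff.2 (Equiv.Perm.sameCycle_pow_left.2 (.refl _ _))

theorem faceOf_rot (d : H.Dart) : E.faceOf (E.rot d) = E.faceOf d.symm := by
  rw [← E.faceOf_facePerm d.symm, facePerm_apply, SimpleGraph.Dart.symm_symm]

/-- The edges which separate a set of faces from its complement meet every vertex an even number of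
times, hence they do not form a nonempty forest. -/
theorem mem_iff_mem_symm_of_isAcyclic [Finite V] {T : SimpleGraph V} (hT : T.IsAcyclic)
    (X : Set E.Face)
    (hX : ∀ d : H.Dart, ¬ T.Adj d.fst d.snd → (E.faceOf d ∈ X ↔ E.faceOf d.symm ∈ X))
    (d : H.Dart) : E.faceOf d ∈ X ↔ E.faceOf d.symm ∈ X := by
  classical
  have := Fintype.ofFinite V
  by_contra hd
  let N : SimpleGraph V :=
    { Adj := fun u v => ∃ h : H.Adj u v,
        ¬ (E.faceOf ⟨(u, v), h⟩ ∈ X ↔ E.faceOf ⟨(v, u), h.symm⟩ ∈ X)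
      symm := ⟨fun u v ⟨h, h'⟩ => ⟨h.symm, fun e => h' e.symm⟩⟩
      loopless := ⟨fun u ⟨h, _⟩ => H.irrefl h⟩ }
  have hN : N ≤ T := by
    rintro u v ⟨h, h'⟩
    by_contra hc
    exact h' (hX ⟨(u, v), h⟩ hc)
  obtain ⟨v, -, w, ⟨hvw, hvw'⟩, huniq⟩ := (hT.anti hN).exists_ne_existsUnique_adj
    (a := d.fst) (b := d.snd) ⟨d.adj, hd⟩ d.fst
  let χ : H.Dart → ℤ := fun d => if E.faceOf d ∈ X then 1 else 0
  have h1 : ∑ d with d.fst = v, χ (E.rot d) = ∑ d with d.fst = v, χ d :=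
    Finset.sum_equiv E.rot (fun d => by simp [E.rot_fst]) (fun _ _ => rfl)
  have h2 : ∑ d with d.fst = v, (χ (E.rot d) - χ d) = 0 := by
    rw [Finset.sum_sub_distrib, h1, sub_self]
  rw [Finset.sum_eq_single (⟨(v, w), hvw⟩ : H.Dart)] at h2
  · simp only [χ, faceOf_rot, SimpleGraph.Dart.symm_mk, Prod.swap_prod_mk] at h2
    split_ifs at h2 <;> simp_all
  · rintro ⟨⟨a, b⟩, hab⟩ hd hne
    simp only [Finset.mem_filter, Finset.mem_univ, true_and] at hd
    subst hd
    have : ¬ N.Adj a b := fun h => hne (by simp [huniq b h])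
    have h3 : (E.faceOf ⟨(a, b), hab⟩ ∈ X ↔ E.faceOf ⟨(b, a), hab.symm⟩ ∈ X) := by
      by_contra hc
      exact this ⟨hab, hc⟩
    simp only [χ, faceOf_rot, SimpleGraph.Dart.symm_mk, Prod.swap_prod_mk, h3, sub_self]
  · simp

/-- Any two faces of a connected map can be joined by crossing edges. -/
theorem mem_iff_mem_of_forall_symm (hH : H.Connected) (X : Set E.Face)
    (hX : ∀ d : H.Dart, E.faceOf d ∈ X ↔ E.faceOf d.symm ∈ X) (d d' : H.Dart) :
    E.faceOf d ∈ X ↔ E.faceOf d' ∈ X := by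
  have hpow : ∀ d, ∀ n : ℕ, E.faceOf ((E.rot ^ n) d) ∈ X ↔ E.faceOf d ∈ X := by
    intro d n
    induction n with
    | zero => rfl
    | succ n ih =>
      rw [pow_succ', Equiv.Perm.mul_apply, faceOf_rot, ← hX, ih]
  have hrot : ∀ d d' : H.Dart, d.fst = d'.fst → (E.faceOf d ∈ X ↔ E.faceOf d' ∈ X) := by
    intro d d' h
    obtain ⟨n, hn⟩ := E.rot_sameCycle d d' h
    subst hn
    cases n with
    | ofNat n => exact (hpow d n).symm
    | negSucc n =>
      have := hpow ((E.rot ^ (Int.negSucc n)) d) (n + 1)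
      rw [zpow_negSucc] at this ⊢
      rwa [← Equiv.Perm.mul_apply, mul_inv_cancel, Equiv.Perm.one_apply] at this
  obtain ⟨p⟩ := hH d.fst d'.fst
  have : ∀ u v (p : H.Walk u v) (d d' : H.Dart), d.fst = u → d'.fst = v →
      (E.faceOf d ∈ X ↔ E.faceOf d' ∈ X) := by
    intro u v p
    induction p with
    | nil => exact fun d d' h h' => hrot d d' (h.trans h'.symm)
    | cons h p ih =>
      intro d d' hd hd'
      rw [hrot d ⟨(_, _), h⟩ hd, hX]
      exact ih _ _ rfl hd'
  exact this _ _ p d d' rfl rfl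

end RotationSystem

/-! ### Faces of length four and the dual graph -/

namespace RotationSystem

variable {V : Type*} {H : SimpleGraph V} (E : RotationSystem H)

/-- The four darts on the boundary of a face of length four. -/
theorem facePerm_of_length_eq_four [Finite V] {d : H.Dart} (h : (E.faceOf d).length = 4) :
    (E.facePerm ^ 4) d = d ∧ (∀ n, 0 < n → n < 4 → (E.facePerm ^ n) d ≠ d) ∧
      ∀ d', E.faceOf d' = E.faceOf d → ∃ n < 4, (E.facePerm ^ n) d = d' := by
  classical
  have := Fintype.ofFinite V
  let s : Finset H.Dart := Finset.univ.filter fun d' => E.faceOf d' = E.faceOf d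
  have hs : s.card = 4 := by
    rw [← h, Face.length, Nat.card_eq_fintype_card, Fintype.card_subtype]
  have hmem : ∀ d', d' ∈ s ↔ E.faceOf d' = E.faceOf d := by simp [s]
  have hc : E.facePerm.IsCycleOn s := by
    refine ⟨E.facePerm.bijOn fun x => ?_, fun x hx y hy => ?_⟩
    · simp [hmem, faceOf_facePerm]
    · rw [Finset.mem_coe, hmem] at hx hy
      exact E.faceOf_eq_iff.1 (hx.trans hy.symm)
  have hd : d ∈ s := (hmem d).2 rfl
  refine ⟨?_, fun n h0 h4 e => ?_, fun d' hd' => ?_⟩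
  · rw [hc.pow_apply_eq hd, hs]
  · rw [hc.pow_apply_eq hd, hs] at e
    exact absurd (Nat.le_of_dvd h0 e) (by omega)
  · rw [← hs]
    exact hc.exists_pow_eq hd ((hmem d').2 hd')

theorem adj_of_length_eq_four [Finite V] {d : H.Dart} (h : (E.faceOf d).length = 4) :
    H.Adj d.fst d.snd ∧ H.Adj d.snd (E.facePerm d).snd ∧
      H.Adj (E.facePerm d).snd ((E.facePerm ^ 2) d).snd ∧
      H.Adj ((E.facePerm ^ 2) d).snd d.fst := by
  have h4 := (E.facePerm_of_length_eq_four h).1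
  have s1 := E.facePerm_pow_succ_fst d 0
  have s2 := E.facePerm_pow_succ_fst d 1
  have s3 := E.facePerm_pow_succ_fst d 2
  have s4 := E.facePerm_pow_succ_fst d 3
  have e1 := ((E.facePerm ^ 1) d).adj
  have e2 := ((E.facePerm ^ 2) d).adj
  have e3 := ((E.facePerm ^ 3) d).adj
  rw [h4] at s4
  rw [s1] at e1
  rw [s2] at e2
  rw [s3, ← s4] at e3
  exact ⟨d.adj, e1, e2, e3⟩

theorem hasVertex_iff_of_length_eq_four [Finite V] {d : H.Dart} (h : (E.faceOf d).length = 4)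
    (v : V) : (E.faceOf d).HasVertex v ↔
      v = d.fst ∨ v = d.snd ∨ v = (E.facePerm d).snd ∨ v = ((E.facePerm ^ 2) d).snd := by
  have hall := (E.facePerm_of_length_eq_four h).2.2
  constructor
  · rintro ⟨d', hd', rfl⟩
    obtain ⟨n, hn, rfl⟩ := hall d' hd'
    interval_cases n
    · exact Or.inl rfl
    · exact Or.inr (Or.inl (E.facePerm_pow_succ_fst d 0))
    · exact Or.inr (Or.inr (Or.inl (E.facePerm_pow_succ_fst d 1)))
    · exact Or.inr (Or.inr (Or.inr (E.facePerm_pow_succ_fst d 2)))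
  · rintro (rfl | rfl | rfl | rfl)
    · exact ⟨d, rfl, rfl⟩
    · exact ⟨_, E.faceOf_facePerm_pow d 1, E.facePerm_pow_succ_fst d 0⟩
    · exact ⟨_, E.faceOf_facePerm_pow d 2, E.facePerm_pow_succ_fst d 1⟩
    · exact ⟨_, E.faceOf_facePerm_pow d 3, E.facePerm_pow_succ_fst d 2⟩

/-- The two faces on the sides of a dart. -/
def sides (d : H.Dart) : Sym2 E.Face := s(E.faceOf d, E.faceOf d.symm)

theorem sides_eq_of_edge_eq {d d' : H.Dart} (h : d.edge = d'.edge) : E.sides d = E.sides d' := by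
  rcases (SimpleGraph.dart_edge_eq_iff d d').1 h with rfl | rfl
  · rfl
  · rw [sides, sides, SimpleGraph.Dart.symm_symm, Sym2.eq_swap]

end RotationSystem

/-! ### The fundamental group of a plane graph -/

namespace PlaneEmbedding

open RotationSystem

variable {V : Type*} {H : SimpleGraph V} (E : PlaneEmbedding H)

/-- The edges of a plane graph outside a spanning tree form a spanning tree of the dual graph. -/
theorem exists_dual_isTree [Finite V] {T : SimpleGraph V} (hT : T.IsTree) (hTH : T ≤ H) :
    ∃ D : SimpleGraph E.Face, D.IsTree ∧
      (∀ d : H.Dart, ¬ T.Adj d.fst d.snd → E.sides d ∈ D.edgeSet) ∧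
      ∀ d d' : H.Dart, ¬ T.Adj d.fst d.snd → ¬ T.Adj d'.fst d'.snd →
        E.sides d = E.sides d' → d.edge = d'.edge := by
  classical
  have := Fintype.ofFinite V
  have : Finite E.Face := Quotient.finite _
  -- A connected graph without edges has one vertex and here no faces, against Euler's formula.
  have hne : Nonempty H.Dart := by
    by_contra hc
    rw [not_nonempty_iff] at hc
    have h1 : IsEmpty E.Face := ⟨fun p => Quotient.inductionOn p fun d => hc.elim d⟩
    have h2 : Nat.card H.edgeSet = 0 := by
      rw [Nat.card_eq_zero]
      left
      refine ⟨fun ⟨e, he⟩ => ?_⟩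
      induction e with
      | _ u v => exact hc.elim ⟨(u, v), he⟩
    have h3 : Subsingleton V := by
      refine ⟨fun u v => ?_⟩
      obtain ⟨p⟩ := E.connected u v
      cases p with
      | nil => rfl
      | cons h _ => exact (hc.elim ⟨(_, _), h⟩)
    have h4 : Nat.card V ≤ 1 := Finite.card_le_one_iff_subsingleton.2 h3
    have h5 : Nat.card E.toRotationSystem.Face = 0 := @Nat.card_of_isEmpty _ h1
    have := E.euler
    omega
  -- The dual graph on the edges outside `T`.
  let D' : SimpleGraph E.Face :=
    { Adj := fun p q => p ≠ q ∧ ∃ d : H.Dart, ¬ T.Adj d.fst d.snd ∧ E.sides d = s(p, q)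
      symm := ⟨fun p q ⟨h, d, hd, e⟩ => ⟨h.symm, d, hd, e.trans Sym2.eq_swap⟩⟩
      loopless := ⟨fun p h => h.1 rfl⟩ }
  have hD' : D'.Connected := by
    obtain ⟨d₀⟩ := hne
    refine SimpleGraph.connected_iff_exists_forall_reachable _ |>.2 ⟨E.faceOf d₀, fun p => ?_⟩
    let X : Set E.Face := {p | D'.Reachable (E.faceOf d₀) p}
    have hX : ∀ d : H.Dart, ¬ T.Adj d.fst d.snd → (E.faceOf d ∈ X ↔ E.faceOf d.symm ∈ X) := by
      intro d hd
      by_cases h : E.faceOf d = E.faceOf d.symm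
      · rw [h]
      · have hadj : D'.Adj (E.faceOf d) (E.faceOf d.symm) := ⟨h, d, hd, rfl⟩
        exact ⟨fun hx => hx.trans hadj.reachable, fun hx => hx.trans hadj.symm.reachable⟩
    have hX' := E.mem_iff_mem_symm_of_isAcyclic hT.isAcyclic X hX
    induction p using Quotient.inductionOn with
    | _ d =>
      exact (E.mem_iff_mem_of_forall_symm E.connected X hX' d₀ d).1 (.refl _)
  obtain ⟨D, hDD', hD⟩ := hD'.exists_isTree_le
  have hch : ∀ e : D.edgeSet, ∃ d : H.Dart, ¬ T.Adj d.fst d.snd ∧ E.sides d = e := by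
    rintro ⟨e, he⟩
    induction e with
    | _ p q => exact (hDD' he).2
  choose c hcT hcs using hch
  -- By Euler's formula, there are as many edges outside `T` as edges of `D`.
  let Φ : D.edgeSet → {e : Sym2 V // e ∈ H.edgeSet ∧ e ∉ T.edgeSet} := fun e =>
    ⟨(c e).edge, (c e).edge_mem, hcT e⟩
  have hinj : Function.Injective Φ := by
    intro e e' h
    have h' : (c e).edge = (c e').edge := congrArg Subtype.val h
    exact Subtype.ext (by rw [← hcs e, ← hcs e', E.sides_eq_of_edge_eq h'])
  have hcard : Nat.card {e : Sym2 V // e ∈ H.edgeSet ∧ e ∉ T.edgeSet} = Nat.card D.edgeSet := by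
    have h1 : Nat.card D.edgeSet + 1 = Nat.card E.Face :=
      (SimpleGraph.isTree_iff_connected_and_card.1 hD).2
    have h2 : Nat.card T.edgeSet + 1 = Nat.card V :=
      (SimpleGraph.isTree_iff_connected_and_card.1 hT).2
    have h3 : Nat.card {e : Sym2 V // e ∈ H.edgeSet ∧ e ∉ T.edgeSet} + Nat.card T.edgeSet =
        Nat.card H.edgeSet := by
      have := Set.ncard_sdiff_add_ncard_of_subset (SimpleGraph.edgeSet_mono hTH)
        (Set.toFinite H.edgeSet)
      exact this
    have h4 := E.euler
    have h5 : Nat.card E.Face = Nat.card E.toRotationSystem.Face := rfl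
    omega
  have hsurj : Function.Surjective Φ :=
    ((Nat.bijective_iff_injective_and_card Φ).2 ⟨hinj, hcard.symm⟩).2
  have hex : ∀ d : H.Dart, ¬ T.Adj d.fst d.snd → ∃ e : D.edgeSet, (c e).edge = d.edge := by
    intro d hd
    obtain ⟨e, he⟩ := hsurj ⟨d.edge, d.edge_mem, hd⟩
    exact ⟨e, congrArg Subtype.val he⟩
  refine ⟨D, hD, fun d hd => ?_, fun d d' hd hd' h => ?_⟩
  · obtain ⟨e, he⟩ := hex d hd
    rw [← E.sides_eq_of_edge_eq he, hcs]
    exact e.2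
  · obtain ⟨e, he⟩ := hex d hd
    obtain ⟨e', he'⟩ := hex d' hd'
    have : e = e' := Subtype.ext (by
      rw [← hcs e, ← hcs e', E.sides_eq_of_edge_eq he, E.sides_eq_of_edge_eq he', h])
    rw [← he, ← he', this]

/-- Let all faces of a plane graph but the outer one have length four. A group-valued function on
the darts whose product around each of these faces is trivial is a coboundary: in other words,
these faces fill a disk, so that they kill the fundamental group of the graph. -/
theorem exists_potential [Finite V] (outer : E.Face)
    (hquad : ∀ p : E.Face, p ≠ outer → p.length = 4) {Γ : Type*} [Group Γ]
    (l : V → V → Γ) (hl : ∀ u v, l v u = (l u v)⁻¹)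
    (hface : ∀ d : H.Dart, E.faceOf d ≠ outer →
      l d.fst d.snd * l d.snd (E.facePerm d).snd *
        l (E.facePerm d).snd ((E.facePerm ^ 2) d).snd *
        l ((E.facePerm ^ 2) d).snd d.fst = 1) :
    ∃ g : V → Γ, ∀ u v, H.Adj u v → l u v = (g u)⁻¹ * g v := by
  classical
  have := Fintype.ofFinite V
  obtain ⟨T, hTH, hT⟩ := E.connected.exists_isTree_le
  have : Finite E.Face := Quotient.finite _
  obtain ⟨g, hg⟩ := hT.exists_potential l hl
  obtain ⟨D, hD, hDs, hDe⟩ := E.exists_dual_isTree hT hTH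
  -- After a change of gauge the function is trivial on `T`.
  let m : V → V → Γ := fun u v => g u * l u v * (g v)⁻¹
  have hm : ∀ u v, m v u = (m u v)⁻¹ := by
    intro u v
    simp only [m, hl u v]
    group
  have hmT : ∀ u v, T.Adj u v → m u v = 1 := by
    intro u v h
    simp only [m, hg u v h]
    group
  have hmface : ∀ d : H.Dart, E.faceOf d ≠ outer →
      m d.fst d.snd * m d.snd (E.facePerm d).snd *
        m (E.facePerm d).snd ((E.facePerm ^ 2) d).snd *
        m ((E.facePerm ^ 2) d).snd d.fst = 1 := by
    intro d hd
    have h1 : ∀ a b c e : V, m a b * m b c * m c e * m e a =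
        g a * (l a b * l b c * l c e * l e a) * (g a)⁻¹ := by
      intro a b c e
      simp only [m]
      group
    rw [h1, hface d hd]
    group
  suffices h : ∀ u v, H.Adj u v → m u v = 1 by
    refine ⟨g, fun u v huv => ?_⟩
    have := h u v huv
    simp only [m] at this
    rw [mul_inv_eq_one] at this
    rw [← this]
    group
  by_contra! hcon
  obtain ⟨u₀, v₀, huv₀, hmuv₀⟩ := hcon
  -- The dual edges on which it is still nontrivial form a forest.
  let N : SimpleGraph E.Face :=
    { Adj := fun p q => p ≠ q ∧ ∃ d : H.Dart, m d.fst d.snd ≠ 1 ∧ E.sides d = s(p, q)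
      symm := ⟨fun p q ⟨h, d, hd, e⟩ => ⟨h.symm, d, hd, e.trans Sym2.eq_swap⟩⟩
      loopless := ⟨fun p h => h.1 rfl⟩ }
  have hnT : ∀ d : H.Dart, m d.fst d.snd ≠ 1 → ¬ T.Adj d.fst d.snd := fun d hd h => hd (hmT _ _ h)
  have hND : N ≤ D := by
    rintro p q ⟨-, d, hd, e⟩
    have := hDs d (hnT d hd)
    rwa [e] at this
  have hNadj : ∀ d : H.Dart, m d.fst d.snd ≠ 1 → N.Adj (E.faceOf d) (E.faceOf d.symm) := by
    intro d hd
    have : D.Adj (E.faceOf d) (E.faceOf d.symm) := hDs d (hnT d hd)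
    exact ⟨this.ne, d, hd, rfl⟩
  obtain ⟨p, hp, q, hpq, huniq⟩ := (hD.isAcyclic.anti hND).exists_ne_existsUnique_adj
    (hNadj ⟨(u₀, v₀), huv₀⟩ hmuv₀) outer
  obtain ⟨d, hd, hdp, hdq⟩ : ∃ d : H.Dart, m d.fst d.snd ≠ 1 ∧ E.faceOf d = p ∧
      E.faceOf d.symm = q := by
    obtain ⟨-, d, hd, e⟩ := hpq
    rcases Sym2.eq_iff.1 e with ⟨h1, h2⟩ | ⟨h1, h2⟩
    · exact ⟨d, hd, h1, h2⟩
    · refine ⟨d.symm, ?_, h2, by rwa [SimpleGraph.Dart.symm_symm]⟩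
      change m d.snd d.fst ≠ 1
      rwa [hm, inv_ne_one]
  have hother : ∀ d' : H.Dart, E.faceOf d' = p → d' ≠ d → m d'.fst d'.snd = 1 := by
    intro d' hd' hne
    by_contra hc
    have hq : E.faceOf d'.symm = q := huniq _ (by rw [← hd']; exact hNadj d' hc)
    have he : d'.edge = d.edge := hDe d' d (hnT _ hc) (hnT _ hd) (by
      rw [sides, sides, hd', hq, hdp, hdq])
    rcases (SimpleGraph.dart_edge_eq_iff d' d).1 he with h | h
    · exact hne h
    · rw [h, hdq] at hd'
      exact hpq.ne hd'.symm
  have hlen : (E.faceOf d).length = 4 := by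
    rw [hdp]
    exact hquad p hp
  obtain ⟨h4, hdist, -⟩ := E.facePerm_of_length_eq_four hlen
  -- At a leaf face `p`, only one of the four factors can be nontrivial.
  have hone : ∀ n, 0 < n → n < 4 →
      m ((E.facePerm ^ n) d).fst ((E.facePerm ^ n) d).snd = 1 := fun n h0 h4 =>
    hother _ ((E.faceOf_facePerm_pow d n).trans hdp) (hdist n h0 h4)
  have e1 := hone 1 (by omega) (by omega)
  have e2 := hone 2 (by omega) (by omega)
  have e3 := hone 3 (by omega) (by omega)
  have s1 := E.facePerm_pow_succ_fst d 0
  have s2 := E.facePerm_pow_succ_fst d 1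
  have s3 := E.facePerm_pow_succ_fst d 2
  have s4 := E.facePerm_pow_succ_fst d 3
  simp only [zero_add, pow_zero, pow_one, Equiv.Perm.one_apply, Nat.reduceAdd, h4] at e1 s1 s2 s3 s4
  rw [s1] at e1
  rw [s2] at e2
  rw [s3, ← s4] at e3
  have := hmface d (by rw [hdp]; exact hp)
  rw [e1, e2, e3, mul_one, mul_one, mul_one] at this
  exact hd this

end PlaneEmbedding

/-! ### Reduced words -/

/-- Multiplication of a reduced word by a letter in the free product of groups of order two. -/
def pushLetter {α : Type*} [DecidableEq α] (s : α) : List α → List α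
  | [] => [s]
  | t :: w => if s = t then w else s :: t :: w

/-- The reduced words: no two consecutive letters are the same. These are the vertices of a regular
tree, in which the neighbors of a word are obtained from it by `pushLetter`. -/
def ReducedWord (α : Type*) : Type _ := {w : List α // w.IsChain (· ≠ ·)}

section Words

variable {α : Type*} [DecidableEq α]

theorem isChain_pushLetter (s : α) {w : List α} (hw : w.IsChain (· ≠ ·)) :
    (pushLetter s w).IsChain (· ≠ ·) := by
  cases w with
  | nil => simp [pushLetter]
  | cons t w =>
    rw [pushLetter]
    split_ifs with h
    · exact hw.tail
    · exact List.isChain_cons_cons.2 ⟨h, hw⟩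

theorem pushLetter_eq_cons {s : α} {w : List α} (hw : (s :: w).IsChain (· ≠ ·)) :
    pushLetter s w = s :: w := by
  cases w with
  | nil => rfl
  | cons t w => rw [pushLetter, if_neg (List.isChain_cons_cons.1 hw).1]

theorem pushLetter_pushLetter (s : α) {w : List α} (hw : w.IsChain (· ≠ ·)) :
    pushLetter s (pushLetter s w) = w := by
  cases w with
  | nil => simp [pushLetter]
  | cons t w =>
    by_cases h : s = t
    · subst h
      rw [pushLetter, if_pos rfl, pushLetter_eq_cons hw]
    · rw [pushLetter, if_neg h, pushLetter, if_pos rfl]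

/-- Multiplication by a letter, as an involution of the tree of reduced words. -/
def letterPerm (s : α) : Equiv.Perm (ReducedWord α) :=
  Function.Involutive.toPerm (fun w => ⟨pushLetter s w.1, isChain_pushLetter s w.2⟩)
    fun w => Subtype.ext (pushLetter_pushLetter s w.2)

theorem letterPerm_apply (s : α) (w : ReducedWord α) :
    (letterPerm s w).1 = pushLetter s w.1 := rfl

theorem letterPerm_mul_self (s : α) : letterPerm s * letterPerm s = 1 :=
  Equiv.ext fun w => Subtype.ext (pushLetter_pushLetter s w.2)

theorem letterPerm_inv (s : α) : (letterPerm s)⁻¹ = letterPerm s :=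
  inv_eq_of_mul_eq_one_left (letterPerm_mul_self s)

/-- The action of a word on the tree of reduced words. -/
def wordPerm (w : List α) : Equiv.Perm (ReducedWord α) := (w.map letterPerm).prod

@[simp] theorem wordPerm_nil : wordPerm ([] : List α) = 1 := rfl

@[simp] theorem wordPerm_cons (s : α) (w : List α) :
    wordPerm (s :: w) = letterPerm s * wordPerm w := by simp [wordPerm]

@[simp] theorem wordPerm_append (w w' : List α) :
    wordPerm (w ++ w') = wordPerm w * wordPerm w' := by simp [wordPerm]

/-- The empty word, the root of the tree. -/
def ReducedWord.nil : ReducedWord α := ⟨[], List.isChain_nil⟩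

theorem wordPerm_apply_nil {w : List α} (hw : w.IsChain (· ≠ ·)) :
    (wordPerm w ReducedWord.nil).1 = w := by
  induction w with
  | nil => rfl
  | cons s w ih =>
    rw [wordPerm_cons, Equiv.Perm.mul_apply, letterPerm_apply, ih hw.tail, pushLetter_eq_cons hw]

theorem length_wordPerm_apply_le (w : List α) (x : ReducedWord α) :
    (wordPerm w x).1.length ≤ w.length + x.1.length := by
  induction w with
  | nil => simp
  | cons s w ih =>
    rw [wordPerm_cons, Equiv.Perm.mul_apply, letterPerm_apply]
    have : ∀ l : List α, (pushLetter s l).length ≤ l.length + 1 := by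
      intro l
      cases l with
      | nil => simp [pushLetter]
      | cons t l =>
        rw [pushLetter]
        split_ifs <;> simp
        omega
    have := this (wordPerm w x).1
    simp only [List.length_cons]
    omega

theorem mem_of_mem_wordPerm_apply {w : List α} {x : ReducedWord α} {t : α}
    (h : t ∈ (wordPerm w x).1) : t ∈ w ∨ t ∈ x.1 := by
  induction w with
  | nil => exact Or.inr h
  | cons s w ih =>
    rw [wordPerm_cons, Equiv.Perm.mul_apply, letterPerm_apply] at h
    have : t = s ∨ t ∈ (wordPerm w x).1 := by
      revert h
      generalize (wordPerm w x).1 = l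
      intro h
      cases l with
      | nil => simpa [pushLetter] using h
      | cons r l =>
        rw [pushLetter] at h
        split_ifs at h with hr
        · exact Or.inr (List.mem_cons_of_mem _ h)
        · exact List.mem_cons.1 h
    rcases this with rfl | h
    · simp
    · rcases ih h with h | h
      · exact Or.inl (List.mem_cons_of_mem _ h)
      · exact Or.inr h

/-- In the rooted tree of words, where the ancestors of a word are its suffixes, a word and its
image under the action of `w` have a common ancestor at total distance at most the length of `w`. -/
theorem exists_drop_eq_drop (w : List α) (x : ReducedWord α) :
    ∃ i j, i ≤ x.1.length ∧ j ≤ (wordPerm w x).1.length ∧ i + j ≤ w.length ∧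
      x.1.drop i = (wordPerm w x).1.drop j := by
  induction w with
  | nil => exact ⟨0, 0, by simp⟩
  | cons s w ih =>
    obtain ⟨i, j, hi, hj, hij, e⟩ := ih
    rw [wordPerm_cons, Equiv.Perm.mul_apply, letterPerm_apply]
    revert hj e
    generalize (wordPerm w x).1 = l
    intro hj e
    cases l with
    | nil =>
      refine ⟨i, 1, hi, by simp [pushLetter], ?_, by simpa [pushLetter] using e⟩
      simp only [List.length_cons]
      omega
    | cons t l =>
      rw [pushLetter]
      split_ifs with h
      · cases j with
        | succ j =>
          refine ⟨i, j, hi, by simpa using hj, ?_, by simpa using e⟩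
          simp only [List.length_cons]
          omega
        | zero =>
          have hlen := congrArg List.length e
          simp only [List.length_drop, List.length_cons] at hlen
          refine ⟨i + 1, 0, by omega, by simp, ?_, ?_⟩
          · simp only [List.length_cons]
            omega
          · rw [← List.drop_drop, e]
            simp
      · refine ⟨i, j + 1, hi, by simpa using hj, ?_, by simpa using e⟩
        simp only [List.length_cons]
        omega

end Words

/-! ### Color words of walks -/

/-- The word of the color differences between consecutive vertices; differences are sums, as `Color`
has characteristic two. For a proper coloring and a walk the letter `0` does not occur. -/
def colorWord {V : Type*} (c : V → Color) : List V → List Color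
  | x :: y :: l => (c x + c y) :: colorWord c (y :: l)
  | _ => []

section ColorWord

variable {V W : Type*} (c : V → Color)

@[simp] theorem colorWord_nil : colorWord c [] = [] := rfl

@[simp] theorem colorWord_singleton (x : V) : colorWord c [x] = [] := rfl

@[simp] theorem colorWord_cons_cons (x y : V) (l : List V) :
    colorWord c (x :: y :: l) = (c x + c y) :: colorWord c (y :: l) := rfl

theorem colorWord_map (f : W → V) : ∀ l : List W,
    colorWord c (l.map f) = colorWord (fun x => c (f x)) l
  | [] => rfl
  | [_] => rfl
  | _ :: y :: l => congrArg (_ :: ·) (colorWord_map f (y :: l))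

theorem colorWord_append_cons : ∀ (l : List V) (x : V) (l' : List V),
    colorWord c (l ++ x :: l') = colorWord c (l ++ [x]) ++ colorWord c (x :: l')
  | [], _, _ => rfl
  | [_], _, _ => rfl
  | _ :: z :: l, x, l' => congrArg (_ :: ·) (colorWord_append_cons (z :: l) x l')

variable {G : SimpleGraph V}

theorem colorWord_support_cons {u v w : V} (h : G.Adj u v) (p : G.Walk v w) :
    colorWord c (p.cons h).support = (c u + c v) :: colorWord c p.support := by
  cases p <;> rfl

theorem length_colorWord_support {u v : V} (p : G.Walk u v) :
    (colorWord c p.support).length = p.length := by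
  induction p with
  | nil => rfl
  | cons h p ih => rw [colorWord_support_cons, List.length_cons, ih, SimpleGraph.Walk.length_cons]

theorem colorWord_support_append {u v w : V} (p : G.Walk u v) (q : G.Walk v w) :
    colorWord c (p.append q).support = colorWord c p.support ++ colorWord c q.support := by
  induction p with
  | nil => rfl
  | cons h p ih => rw [SimpleGraph.Walk.cons_append, colorWord_support_cons, ih,
      colorWord_support_cons, List.cons_append]

/-- The action of the color word of a walk on the tree of reduced words. -/
def holonomy (l : List V) : Equiv.Perm (ReducedWord Color) := wordPerm (colorWord c l)

theorem holonomy_support_cons {u v w : V} (h : G.Adj u v) (p : G.Walk v w) :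
    holonomy c (p.cons h).support = letterPerm (c u + c v) * holonomy c p.support := by
  rw [holonomy, colorWord_support_cons, wordPerm_cons, holonomy]

theorem holonomy_support_append {u v w : V} (p : G.Walk u v) (q : G.Walk v w) :
    holonomy c (p.append q).support = holonomy c p.support * holonomy c q.support := by
  rw [holonomy, colorWord_support_append, wordPerm_append, holonomy, holonomy]

theorem holonomy_retractStep {u v : V} {p q : G.Walk u v} (h : RetractStep p q) :
    holonomy c q.support = holonomy c p.support := by
  obtain ⟨p, h, h', q⟩ := h
  rw [holonomy_support_append, holonomy_support_append, holonomy_support_cons,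
    holonomy_support_cons, ← mul_assoc (letterPerm _), add_comm (c _) (c _), letterPerm_mul_self,
    one_mul]

theorem holonomy_eq_of_reflTransGen {u v : V} {p q : G.Walk u v}
    (h : Relation.ReflTransGen RetractStep p q) :
    holonomy c q.support = holonomy c p.support := by
  induction h with
  | refl => rfl
  | tail _ h ih => rw [holonomy_retractStep c h, ih]

/-- If the letters of the edges act as the differences of a potential, then the holonomy of a walk
depends only on its ends. -/
theorem holonomy_eq_of_potential {g : V → Equiv.Perm (ReducedWord Color)}
    (hg : ∀ u v, G.Adj u v → letterPerm (c u + c v) = (g u)⁻¹ * g v) {u v : V} (p : G.Walk u v) :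
    holonomy c p.support = (g u)⁻¹ * g v := by
  induction p with
  | nil => simp [holonomy]
  | cons h p ih =>
    rw [holonomy_support_cons, ih, hg _ _ h]
    group

end ColorWord

/-! ### Retractions of walks -/

section Retractions

variable {V : Type*} {G : SimpleGraph V}

theorem RetractStep.length_add_two {u v : V} {p q : G.Walk u v} (h : RetractStep p q) :
    q.length + 2 = p.length := by
  obtain ⟨p, h, h', q⟩ := h
  simp only [SimpleGraph.Walk.length_append, SimpleGraph.Walk.length_cons]
  omega

theorem RetractStep.support_subset {u v : V} {p q : G.Walk u v} (h : RetractStep p q) :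
    q.support ⊆ p.support := by
  obtain ⟨p, h, h', q⟩ := h
  intro x hx
  simp only [SimpleGraph.Walk.mem_support_append_iff, SimpleGraph.Walk.support_cons,
    List.mem_cons] at hx ⊢
  tauto

theorem RetractStep.cons {u v w : V} (h : G.Adj u v) {p q : G.Walk v w} (hpq : RetractStep p q) :
    RetractStep (p.cons h) (q.cons h) := by
  obtain ⟨p, h₁, h₂, q⟩ := hpq
  exact RetractStep.mk (p.cons h) h₁ h₂ q

theorem exists_isTopologicalRetract {u v : V} (p : G.Walk u v) :
    ∃ q, IsTopologicalRetract p q := by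
  induction hn : p.length using Nat.strong_induction_on generalizing p with
  | _ n ih =>
    by_cases h : ∃ q, RetractStep p q
    · obtain ⟨q, hq⟩ := h
      obtain ⟨r, hr, hr'⟩ := ih q.length (by have := hq.length_add_two; omega) q rfl
      exact ⟨r, hr.head hq, hr'⟩
    · push Not at h
      exact ⟨p, .refl, h⟩

theorem support_subset_of_reflTransGen {u v : V} {p q : G.Walk u v}
    (h : Relation.ReflTransGen RetractStep p q) : q.support ⊆ p.support := by
  induction h with
  | refl => exact List.Subset.refl _
  | tail _ h ih => exact fun x hx => ih (h.support_subset hx)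

/-- A one-step retraction of a closed walk is a one-step retraction of the cyclic sequence. -/
theorem RetractStep.cyclicRetractStep {u : V} {p q : G.Walk u u} (h : RetractStep p q) :
    CyclicRetractStep (cyclicSequence p) (cyclicSequence q) := by
  obtain @⟨x, y, p, h, h', q⟩ := h
  have e1 : (p.append (.cons h (.cons h' q))).support.tail =
      p.support.tail ++ y :: x :: q.support.tail := by
    rw [SimpleGraph.Walk.tail_support_append, SimpleGraph.Walk.support_cons,
      SimpleGraph.Walk.support_cons, ← SimpleGraph.Walk.cons_tail_support q]
    rfl
  have e2 : (p.append q).support.tail = p.support.tail ++ q.support.tail :=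
    SimpleGraph.Walk.tail_support_append _ _
  have hlast : ∀ {a b : V} (r : G.Walk a b), r.support.tail ≠ [] →
      ∃ l, r.support.tail = l ++ [b] := by
    intro a b r hr
    refine ⟨r.support.tail.dropLast, ?_⟩
    conv_lhs => rw [← List.dropLast_append_getLast hr]
    rw [List.getLast_tail, SimpleGraph.Walk.getLast_support]
  simp only [cyclicSequence, e1, e2]
  by_cases hp : p.support.tail = []
  · have hux : u = x := by
      cases p with
      | nil => rfl
      | cons h p => simp at hp
    subst hux
    by_cases hq : q.support.tail = []
    · rw [hp, hq]
      have : (([] ++ y :: u :: [] : List V) : Cycle V) = ([u, y] : List V) :=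
        Cycle.coe_eq_coe.2 (List.isRotated_append (l := [y]) (l' := [u]))
      rw [this]
      exact CyclicRetractStep.two u y
    · obtain ⟨l, hl⟩ := hlast q hq
      rw [hp, hl]
      have h1 : (([] ++ y :: u :: (l ++ [u]) : List V) : Cycle V) =
          (u :: y :: u :: l : List V) :=
        Cycle.coe_eq_coe.2 (List.isRotated_append (l := y :: u :: l) (l' := [u]))
      have h2 : (([] ++ (l ++ [u]) : List V) : Cycle V) = (u :: l : List V) :=
        Cycle.coe_eq_coe.2 (List.isRotated_append (l := l) (l' := [u]))
      rw [h1, h2]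
      exact CyclicRetractStep.mk u y l
  · obtain ⟨l, hl⟩ := hlast p hp
    rw [hl]
    have h1 : ((l ++ [x] ++ y :: x :: q.support.tail : List V) : Cycle V) =
        (x :: y :: x :: (q.support.tail ++ l) : List V) :=
      Cycle.coe_eq_coe.2 (by
        rw [List.append_assoc]
        exact List.isRotated_append (l := l) (l' := x :: y :: x :: q.support.tail))
    have h2 : ((l ++ [x] ++ q.support.tail : List V) : Cycle V) =
        (x :: (q.support.tail ++ l) : List V) :=
      Cycle.coe_eq_coe.2 (by
        rw [List.append_assoc]
        exact List.isRotated_append (l := l) (l' := x :: q.support.tail))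
    rw [h1, h2]
    exact CyclicRetractStep.mk x y _

/-- The holonomy around a cyclic sequence of vertices, starting from the first one. -/
def cyclicHolonomy (c : V → Color) : List V → Equiv.Perm (ReducedWord Color)
  | [] => 1
  | x :: l => holonomy c (x :: (l ++ [x]))

theorem cyclicHolonomy_rotate_one (c : V → Color) (x : V) (l : List V)
    (h : cyclicHolonomy c (x :: l) = 1) : cyclicHolonomy c (l ++ [x]) = 1 := by
  cases l with
  | nil => exact h
  | cons y l =>
    simp only [cyclicHolonomy, holonomy, List.cons_append, colorWord_cons_cons, wordPerm_cons]
      at h ⊢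
    have e := colorWord_append_cons c (y :: l) x [y]
    simp only [List.cons_append, colorWord_cons_cons, colorWord_singleton] at e
    rw [List.append_assoc, List.cons_append, List.nil_append, e, wordPerm_append, wordPerm_cons,
      wordPerm_nil, mul_one, add_comm (c x)] at *
    exact mul_eq_one_comm.1 h

theorem cyclicHolonomy_eq_one_of_isRotated (c : V → Color) {l l' : List V} (h : l ~r l')
    (hl : cyclicHolonomy c l = 1) : cyclicHolonomy c l' = 1 := by
  obtain ⟨n, rfl⟩ := h
  induction n with
  | zero => simpa using hl
  | succ n ih =>
    rw [← List.rotate_rotate]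
    revert ih
    generalize l.rotate n = m
    intro ih
    cases m with
    | nil => exact ih
    | cons x m =>
      rw [List.rotate_cons_succ, List.rotate_zero]
      exact cyclicHolonomy_rotate_one c x m ih

theorem cyclicHolonomy_eq_one_of_reflTransGen (c : V → Color) {l : List V}
    (h : Relation.ReflTransGen CyclicRetractStep (l : Cycle V) Cycle.nil) :
    cyclicHolonomy c l = 1 := by
  suffices ∀ s : Cycle V, Relation.ReflTransGen CyclicRetractStep s Cycle.nil →
      ∀ l : List V, (l : Cycle V) = s → cyclicHolonomy c l = 1 from this _ h l rfl
  intro s hs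
  induction hs using Relation.ReflTransGen.head_induction_on with
  | refl =>
    intro l hl
    rw [(Cycle.coe_eq_nil l).1 hl]
    rfl
  | head h _ ih =>
    intro l hl
    cases h with
    | mk x y m =>
      have := ih _ rfl
      refine cyclicHolonomy_eq_one_of_isRotated c (Cycle.coe_eq_coe.1 hl.symm) ?_
      simp only [cyclicHolonomy, holonomy, List.cons_append, colorWord_cons_cons, wordPerm_cons]
        at this ⊢
      rw [← mul_assoc, add_comm (c y), letterPerm_mul_self, one_mul, this]
    | two x y =>
      refine cyclicHolonomy_eq_one_of_isRotated c (Cycle.coe_eq_coe.1 hl.symm) ?_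
      simp only [cyclicHolonomy, holonomy, List.cons_append, List.nil_append, colorWord_cons_cons,
        colorWord_singleton, wordPerm_cons, wordPerm_nil, mul_one]
      rw [add_comm (c y), letterPerm_mul_self]

/-- A null-homotopic closed walk has trivial holonomy. -/
theorem IsNullHomotopic.holonomy_eq_one (c : V → Color) {u : V} {p : G.Walk u u}
    (h : IsNullHomotopic p) : holonomy c p.support = 1 := by
  have h1 := cyclicHolonomy_eq_one_of_reflTransGen c h
  cases p with
  | nil => rfl
  | cons hadj p =>
    have hne : p.support ≠ [] := SimpleGraph.Walk.support_ne_nil p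
    have e : p.support = p.support.dropLast ++ [u] := by
      conv_lhs => rw [← List.dropLast_append_getLast hne]
      rw [SimpleGraph.Walk.getLast_support]
    rw [SimpleGraph.Walk.support_cons, List.tail_cons, e] at h1
    rw [SimpleGraph.Walk.support_cons, e]
    exact cyclicHolonomy_eq_one_of_isRotated c (List.isRotated_append (l' := [u])) h1

end Retractions

/-! ### Walks in the hexagonal grid -/

/-- A vertex of the grid is determined by its hue and color among the neighbors of a vertex. -/
theorem triangularGrid_eq_of_adj {x y z : ℤ × ℤ} (hyx : triangularGrid.graph.Adj y x)
    (hyz : triangularGrid.graph.Adj y z) (hhue : triangularGrid.hue x = triangularGrid.hue z)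
    (hcolor : triangularGrid.color x = triangularGrid.color z) : x = z := by
  obtain ⟨a, b⟩ := x
  obtain ⟨a', b'⟩ := y
  obtain ⟨a'', b''⟩ := z
  have e1 := (ZMod.intCast_eq_intCast_iff_dvd_sub _ _ 2).1 (congrArg Prod.fst hcolor)
  have e2 := (ZMod.intCast_eq_intCast_iff_dvd_sub _ _ 2).1 (congrArg Prod.snd hcolor)
  have e3 := (ZMod.intCast_eq_intCast_iff_dvd_sub _ _ 3).1 hhue
  change gridAdj _ _ at hyx hyz
  simp only [gridAdj, Prod.mk_sub_mk, Prod.mk.injEq] at hyx hyz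
  simp only [Nat.cast_ofNat] at e1 e2 e3
  rw [Prod.mk.injEq]
  rcases hyx with h | h | h | h | h | h <;> omega

/-- The vertices of hue `0` and `1` induce a hexagonal grid, where the color word determines a walk
from its first vertex, so that an irreducible walk has a reduced color word. -/
theorem isChain_colorWord_of_irreducible {u v : ℤ × ℤ} (p : triangularGrid.graph.Walk u v)
    (hp : ∀ x ∈ p.support, triangularGrid.hue x = 0 ∨ triangularGrid.hue x = 1)
    (hirr : ∀ q, ¬ RetractStep p q) :
    (colorWord triangularGrid.color p.support).IsChain (· ≠ ·) := by
  induction p with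
  | nil => simp
  | @cons u v w h p ih =>
    have hp' : ∀ x ∈ p.support, triangularGrid.hue x = 0 ∨ triangularGrid.hue x = 1 :=
      fun x hx => hp x (by simp [hx])
    have ih' := ih hp' fun q hq => hirr _ (hq.cons h)
    cases p with
    | nil => simp
    | @cons _ z _ h' p =>
      rw [colorWord_support_cons, colorWord_support_cons]
      rw [colorWord_support_cons] at ih'
      refine List.isChain_cons_cons.2 ⟨fun e => ?_, ih'⟩
      have hcolor : triangularGrid.color u = triangularGrid.color z := by
        rw [add_comm] at e
        exact add_left_cancel e
      have hhue : triangularGrid.hue u = triangularGrid.hue z := by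
        have h1 := triangularGrid.hue.valid h
        have h2 := triangularGrid.hue.valid h'
        rcases hp u (by simp) with hu | hu <;> rcases hp v (by simp) with hv | hv <;>
          rcases hp z (by simp) with hz | hz <;> simp_all
      obtain rfl := triangularGrid_eq_of_adj h.symm h' hhue hcolor
      exact hirr _ (RetractStep.mk .nil h h' p)

/-- In the hexagonal grid, a closed walk with trivial holonomy is null-homotopic. -/
theorem isNullHomotopic_of_holonomy_eq_one {u : ℤ × ℤ} (p : triangularGrid.graph.Walk u u)
    (hp : ∀ x ∈ p.support, triangularGrid.hue x = 0 ∨ triangularGrid.hue x = 1)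
    (h : holonomy triangularGrid.color p.support = 1) : IsNullHomotopic p := by
  induction hn : p.length using Nat.strong_induction_on generalizing p with
  | _ n ih =>
    by_cases hstep : ∃ q, RetractStep p q
    · obtain ⟨q, hq⟩ := hstep
      have := ih q.length (by have := hq.length_add_two; omega) q
        (fun x hx => hp x (hq.support_subset hx)) (by rw [holonomy_retractStep _ hq, h]) rfl
      exact Relation.ReflTransGen.head hq.cyclicRetractStep this
    · push Not at hstep
      have h1 := wordPerm_apply_nil (isChain_colorWord_of_irreducible p hp hstep)
      rw [← holonomy, h] at h1
      have h2 := length_colorWord_support triangularGrid.color p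
      rw [← h1] at h2
      cases p with
      | nil => exact Relation.ReflTransGen.refl
      | cons _ p =>
        have h3 : 0 = p.length + 1 := h2
        omega

/-! ### Extension of contractions into a tree -/

section Extension

variable {V : Type*} {G : SimpleGraph V} {α : Type*}

theorem SimpleGraph.Walk.parity_of_alternating {b : V → ZMod 2}
    (hb : ∀ u v, G.Adj u v → b v = b u + 1) {u v : V} (p : G.Walk u v) :
    b v = b u + p.length := by
  induction p with
  | nil => simp
  | cons h p ih =>
    rw [ih, hb _ _ h, SimpleGraph.Walk.length_cons]
    push_cast
    ring

/-- A contraction from a set `S` of vertices of a bipartite graph to the rooted tree of words, which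
respects the bipartition, extends to a homomorphism, provided that the root is far away. The vertex
`v` is mapped to the ancestor of `g u` at distance `dist u v` from `g u`, where `u` is chosen so
that this ancestor is as far from the root as possible. -/
theorem exists_extension_to_tree [Finite V] (hG : G.Connected) {b : V → ZMod 2}
    (hb : ∀ u v, G.Adj u v → b v = b u + 1) {S : Set V} (hS : S.Nonempty) (g : V → List α)
    (hfar : ∀ u ∈ S, ∀ v, G.dist u v ≤ (g u).length)
    (hpar : ∀ u ∈ S, ∀ v ∈ S, ((g u).length : ZMod 2) + b u = (g v).length + b v)
    (hlip : ∀ u ∈ S, ∀ v ∈ S, ∃ i j, i ≤ (g u).length ∧ j ≤ (g v).length ∧ i + j ≤ G.dist u v ∧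
      (g u).drop i = (g v).drop j) :
    ∃ F : V → List α, (∀ v ∈ S, F v = g v) ∧ (∀ v, ∃ u ∈ S, F v <:+ g u) ∧
      ∀ v v', G.Adj v v' → (∃ s, F v = s :: F v') ∨ ∃ s, F v' = s :: F v := by
  have hmax : ∀ v, ∃ u ∈ S, ∀ u' ∈ S,
      (g u').length - G.dist u' v ≤ (g u).length - G.dist u v := fun v =>
    Set.exists_max_image S (fun u => (g u).length - G.dist u v) S.toFinite hS
  choose t htS ht using hmax
  let F : V → List α := fun v => (g (t v)).drop (G.dist (t v) v)
  have hlen : ∀ v, (F v).length = (g (t v)).length - G.dist (t v) v := fun v => by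
    simp [F]
  have hdistpar : ∀ u v, b v = b u + (G.dist u v : ZMod 2) := by
    intro u v
    obtain ⟨p, hp⟩ := hG.exists_walk_length_eq_dist u v
    rw [← hp]
    exact p.parity_of_alternating hb
  -- Ancestors of `g u` and `g u'` of equal depth coincide as soon as the sum of their distances from
  -- `g u` and `g u'` is at least `dist u u'`.
  have hdrop : ∀ u ∈ S, ∀ u' ∈ S, ∀ r r', r ≤ (g u).length → r' ≤ (g u').length →
      (g u).length - r = (g u').length - r' → G.dist u u' ≤ r + r' →
      (g u).drop r = (g u').drop r' := by
    intro u hu u' hu' r r' hr hr' he hd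
    obtain ⟨i, j, hi, hj, hij, e⟩ := hlip u hu u' hu'
    have hl := congrArg List.length e
    simp only [List.length_drop] at hl
    have h1 : r = i + (r - i) := by omega
    have h2 : r' = j + (r - i) := by omega
    rw [h1, h2, ← List.drop_drop, ← List.drop_drop, e]
  have hstep : ∀ v v', G.Adj v v' → (F v').length < (F v).length → ∃ s, F v = s :: F v' := by
    intro v v' hadj hlt
    have h1 := ht v' (t v) (htS v)
    have h2 := hfar _ (htS v) v
    have h2' := hfar _ (htS v') v'
    have hv := hlen v
    have hv' := hlen v'
    have h3 : G.dist (t v) v' ≤ G.dist (t v) v + 1 := by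
      have := hG.dist_triangle (u := t v) (v := v) (w := v')
      rwa [SimpleGraph.dist_eq_one_iff_adj.2 hadj] at this
    have h4 : G.dist (t v) (t v') ≤ (G.dist (t v) v + 1) + G.dist (t v') v' := by
      have := hG.dist_triangle (u := t v) (v := v') (w := t v')
      rw [SimpleGraph.dist_comm (u := v') (v := t v')] at this
      omega
    have h5 := hdrop (t v) (htS v) (t v') (htS v') (G.dist (t v) v + 1) (G.dist (t v') v')
      (by omega) h2' (by omega) h4
    have hne : F v ≠ [] := by
      intro h
      rw [h] at hlt
      simp at hlt
    obtain ⟨s, l, hsl⟩ := List.exists_cons_of_ne_nil hne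
    refine ⟨s, ?_⟩
    rw [hsl]
    congr 1
    rw [← List.drop_drop] at h5
    change (F v).drop 1 = F v' at h5
    rw [← h5, hsl]
    rfl
  have hFpar : ∀ v v', ((F v).length : ZMod 2) + b v = (F v').length + b v' := by
    have : ∀ v, ((F v).length : ZMod 2) + b v = (g (t v)).length + b (t v) := by
      intro v
      rw [hlen, hdistpar (t v) v, Nat.cast_sub (hfar _ (htS v) v)]
      ring
    intro v v'
    rw [this, this]
    exact hpar _ (htS v) _ (htS v')
  refine ⟨F, fun v hv => ?_, fun v => ⟨t v, htS v, List.drop_suffix _ _⟩, fun v v' hadj => ?_⟩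
  · have h1 := ht v v hv
    rw [SimpleGraph.dist_self] at h1
    have h2 := hfar _ (htS v) v
    obtain ⟨i, j, hi, hj, hij, e⟩ := hlip (t v) (htS v) v hv
    have hl := congrArg List.length e
    simp only [List.length_drop] at hl
    exact hdrop (t v) (htS v) v hv (G.dist (t v) v) 0 h2 (by omega) (by omega) (by omega)
  · rcases lt_trichotomy (F v).length (F v').length with h | h | h
    · exact Or.inr (hstep v' v hadj.symm h)
    · have := hFpar v v'
      rw [h, hb v v' hadj] at this
      have := add_left_cancel this
      simp at this
    · exact Or.inl (hstep v v' hadj h)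

/-- A closed walk of length four in a tree passes some edge back and forth. -/
theorem eq_or_eq_of_four_walk_in_tree {a b c d : List α}
    (h₁ : (∃ s, a = s :: b) ∨ ∃ s, b = s :: a) (h₂ : (∃ s, b = s :: c) ∨ ∃ s, c = s :: b)
    (h₃ : (∃ s, c = s :: d) ∨ ∃ s, d = s :: c) (h₄ : (∃ s, d = s :: a) ∨ ∃ s, a = s :: d) :
    a = c ∨ b = d := by
  rcases h₁ with ⟨s, hs⟩ | ⟨s, hs⟩ <;> rcases h₂ with ⟨t, ht⟩ | ⟨t, ht⟩ <;>
    rcases h₃ with ⟨u, hu⟩ | ⟨u, hu⟩ <;> rcases h₄ with ⟨w, hw⟩ | ⟨w, hw⟩ <;>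
    have l₁ := congrArg List.length hs <;> have l₂ := congrArg List.length ht <;>
    have l₃ := congrArg List.length hu <;> have l₄ := congrArg List.length hw <;>
    simp only [List.length_cons] at l₁ l₂ l₃ l₄ <;> first | omega | grind

end Extension

/-! ### Lifting the boundary cycle -/

section Lift

variable {V : Type*} {G : SimpleGraph V}

theorem holonomy_eq_prod_range (c : V → Color) {u v : V} (p : G.Walk u v) :
    holonomy c p.support = ((List.range p.length).map fun i =>
      letterPerm (c (p.getVert i) + c (p.getVert (i + 1)))).prod := by
  induction p with
  | nil => simp [holonomy]
  | cons h p ih =>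
    rw [holonomy_support_cons, ih, SimpleGraph.Walk.length_cons, List.range_succ_eq_map]
    simp [List.map_map, Function.comp_def]

/-- If the holonomy around a cycle is trivial, then a potential exists on the cycle. -/
theorem exists_potential_of_isCycle (c : V → Color) {u₀ : V} {C : G.Walk u₀ u₀} (hC : C.IsCycle)
    (h : holonomy c C.support = 1) :
    ∃ g : V → Equiv.Perm (ReducedWord Color), ∀ u v, C.toSubgraph.Adj u v →
      letterPerm (c u + c v) = (g u)⁻¹ * g v := by
  classical
  let P : ℕ → Equiv.Perm (ReducedWord Color) := fun n => ((List.range n).map fun i =>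
      letterPerm (c (C.getVert i) + c (C.getVert (i + 1)))).prod
  have hP : ∀ i, P (i + 1) = P i * letterPerm (c (C.getVert i) + c (C.getVert (i + 1))) := by
    intro i
    simp [P, List.range_succ]
  have hPn : P C.length = 1 := by rw [← h, holonomy_eq_prod_range]
  have hidx : ∀ v, ∃ i, v ∈ C.support → 1 ≤ i ∧ i ≤ C.length ∧ C.getVert i = v := by
    intro v
    by_cases hv : v ∈ C.support
    · obtain ⟨i, hi, hle⟩ := SimpleGraph.Walk.mem_support_iff_exists_getVert.1 hv
      rcases Nat.eq_zero_or_pos i with rfl | h0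
      · refine ⟨C.length, fun _ => ⟨?_, le_rfl, ?_⟩⟩
        · have := hC.three_le_length
          omega
        · rw [← hi, SimpleGraph.Walk.getVert_length, SimpleGraph.Walk.getVert_zero]
      · exact ⟨i, fun _ => ⟨h0, hle, hi⟩⟩
    · exact ⟨0, fun h => absurd h hv⟩
  choose idx hidx using hidx
  have hg : ∀ i ≤ C.length, P (idx (C.getVert i)) = P i := by
    intro i hi
    obtain ⟨h1, h2, h3⟩ := hidx (C.getVert i) (C.getVert_mem_support i)
    rcases Nat.eq_zero_or_pos i with rfl | h0
    · have h4 : idx (C.getVert 0) = C.length := by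
        have hlen := hC.three_le_length
        refine hC.getVert_injOn ⟨h1, h2⟩ ⟨by omega, le_rfl⟩ ?_
        rw [h3, SimpleGraph.Walk.getVert_length, SimpleGraph.Walk.getVert_zero]
      rw [h4, hPn]
      rfl
    · rw [hC.getVert_injOn ⟨h1, h2⟩ ⟨h0, hi⟩ h3]
  refine ⟨fun v => P (idx v), fun u v huv => ?_⟩
  obtain ⟨i, hi, hlt⟩ := C.toSubgraph_adj_iff.1 huv
  have key : letterPerm (c (C.getVert i) + c (C.getVert (i + 1))) =
      (P (idx (C.getVert i)))⁻¹ * P (idx (C.getVert (i + 1))) := by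
    rw [hg i (by omega), hg (i + 1) (by omega), hP]
    group
  rcases Sym2.eq_iff.1 hi with ⟨rfl, rfl⟩ | ⟨rfl, rfl⟩
  · exact key
  · rw [add_comm, ← letterPerm_inv, key]
    group

/-- A path between two vertices of a cycle is a concatenation of edges of the cycle and of
generalized chords, so that a bound additive along concatenations can be checked on these. -/
theorem forall_path_of_generalizedChord {u₀ : V} (C : G.Walk u₀ u₀) {R : V → V → ℕ → Prop}
    (hrefl : ∀ u, R u u 0) (hmono : ∀ u v m n, m ≤ n → R u v m → R u v n)
    (htrans : ∀ u v w m n, R u v m → R v w n → R u w (m + n))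
    (hedge : ∀ u v, C.toSubgraph.Adj u v → R u v 1)
    (hchord : ∀ u v, u ∈ C.support → v ∈ C.support → ∀ P : G.Walk u v,
      IsGeneralizedChord C P → R u v P.length)
    {u v : V} (hu : u ∈ C.support) (hv : v ∈ C.support) (P : G.Walk u v) (hP : P.IsPath) :
    R u v P.length := by
  classical
  induction hn : P.length using Nat.strong_induction_on generalizing u v with
  | _ n ih =>
    subst hn
    by_cases huv : u = v
    · subst huv
      exact hmono _ _ _ _ (Nat.zero_le _) (hrefl u)
    by_cases hx : ∃ x ∈ P.support, x ∈ C.support ∧ x ≠ u ∧ x ≠ v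
    · obtain ⟨x, hxP, hxC, hxu, hxv⟩ := hx
      have hlen := congrArg SimpleGraph.Walk.length (P.take_spec hxP)
      rw [SimpleGraph.Walk.length_append] at hlen
      have h1 : 0 < (P.takeUntil x hxP).length := by
        by_contra h0
        exact hxu (SimpleGraph.Walk.eq_of_length_eq_zero (by omega :
          (P.takeUntil x hxP).length = 0)).symm
      have h2 : 0 < (P.dropUntil x hxP).length := by
        by_contra h0
        exact hxv (SimpleGraph.Walk.eq_of_length_eq_zero (by omega :
          (P.dropUntil x hxP).length = 0))
      rw [← hlen]
      exact htrans _ _ _ _ _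
        (ih _ (by omega) hu hxC _ (hP.takeUntil hxP) rfl)
        (ih _ (by omega) hxC hv _ (hP.dropUntil hxP) rfl)
    · push Not at hx
      have hsupp : ∀ x ∈ P.support, x ∈ C.support → x = u ∨ x = v := fun x hxP hxC => by
        by_cases h : x = u
        · exact Or.inl h
        · exact Or.inr (hx x hxP hxC h)
      have hpos : 0 < P.length := by
        by_contra h0
        exact huv (SimpleGraph.Walk.eq_of_length_eq_zero (by omega : P.length = 0))
      by_cases he : ∃ e ∈ P.edges, e ∈ C.edges
      · obtain ⟨e, heP, heC⟩ := he
        refine hmono _ _ _ _ hpos (hedge u v ?_)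
        rw [SimpleGraph.Walk.adj_toSubgraph_iff_mem_edges]
        induction e with
        | _ a b =>
          have hab : a ≠ b := (C.adj_of_mem_edges heC).ne
          have ha := hsupp a (P.fst_mem_support_of_mem_edges heP)
            (C.fst_mem_support_of_mem_edges heC)
          have hb := hsupp b (P.snd_mem_support_of_mem_edges heP)
            (C.snd_mem_support_of_mem_edges heC)
          rcases ha with rfl | rfl <;> rcases hb with rfl | rfl
          · exact absurd rfl hab
          · exact heC
          · rwa [Sym2.eq_swap]
          · exact absurd rfl hab
      · push Not at he
        refine hchord u v hu hv P ⟨hP, huv, fun x hxP => ⟨hsupp x hxP, ?_⟩, he⟩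
        rintro (rfl | rfl)
        · exact hu
        · exact hv

end Lift

/-! ### Colors and the words of colorings -/

/-- A properly colored four-cycle, all of whose vertices have a common neighbor, has two opposite
vertices of the same color. -/
theorem Color.eq_or_eq_of_wheel {a b c d e : Color} (hab : a ≠ b) (hbc : b ≠ c) (hcd : c ≠ d)
    (hda : d ≠ a) (hae : a ≠ e) (hbe : b ≠ e) (hce : c ≠ e) (hde : d ≠ e) : a = c ∨ b = d := by
  by_contra! h
  have hnodup : [a, b, c, d, e].Nodup := by
    simp [hab, hbc, hcd, hda.symm, hae, hbe, hce, hde, h.1, h.2]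
  have hcard : Fintype.card Color = 4 := rfl
  have hle := hnodup.length_le_card
  rw [hcard] at hle
  exact absurd hle (by simp)

theorem Color.exists_ne_of_three : ∀ a b c : Color, ∃ e, a ≠ e ∧ b ≠ e ∧ c ≠ e := by
  decide

theorem Color.add_self (a : Color) : a + a = 0 := by
  revert a
  decide

/-- The holonomy around a four-cycle with two opposite vertices of the same color is trivial. -/
theorem letterPerm_four_cycle {a b c d : Color} (h : a = c ∨ b = d) :
    letterPerm (a + b) * letterPerm (b + c) * letterPerm (c + d) * letterPerm (d + a) = 1 := by
  rcases h with rfl | rfl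
  · rw [add_comm b a, letterPerm_mul_self, one_mul, add_comm d a, letterPerm_mul_self]
  · rw [mul_assoc (letterPerm (a + b)), add_comm c b, letterPerm_mul_self, mul_one, add_comm b a,
      letterPerm_mul_self]

theorem sum_pushLetter (s : Color) (w : List Color) : (pushLetter s w).sum = s + w.sum := by
  cases w with
  | nil => rfl
  | cons t w =>
    rw [pushLetter]
    split_ifs with h
    · rw [h, List.sum_cons, ← add_assoc, Color.add_self, zero_add]
    · rfl

/-- The sum of the letters is a homomorphism to the group of colors, so that it turns the lift of a
coloring to the tree of reduced words back into the coloring. -/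
theorem sum_wordPerm_apply (w : List Color) (x : ReducedWord Color) :
    (wordPerm w x).1.sum = w.sum + x.1.sum := by
  induction w with
  | nil => simp
  | cons s w ih =>
    rw [wordPerm_cons, Equiv.Perm.mul_apply, letterPerm_apply, sum_pushLetter, ih, List.sum_cons,
      add_assoc]

theorem length_wordPerm_apply_cast {α : Type*} [DecidableEq α] (w : List α) (x : ReducedWord α) :
    ((wordPerm w x).1.length : ZMod 2) = w.length + x.1.length := by
  induction w with
  | nil => simp
  | cons s w ih =>
    have h2 : (1 : ZMod 2) + 1 = 0 := rfl
    have : ∀ l : List α, ((pushLetter s l).length : ZMod 2) = l.length + 1 := by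
      intro l
      cases l with
      | nil => simp [pushLetter]
      | cons t l =>
        rw [pushLetter]
        split_ifs
        · rw [List.length_cons, Nat.cast_succ, add_assoc, h2, add_zero]
        · simp
    rw [wordPerm_cons, Equiv.Perm.mul_apply, letterPerm_apply, this, ih, List.length_cons]
    push_cast
    ring

section ColorWordValues

variable {V : Type*} {G : SimpleGraph V} (c : V → Color)

theorem sum_colorWord_support {u v : V} (p : G.Walk u v) :
    (colorWord c p.support).sum = c u + c v := by
  induction p with
  | nil => simp [Color.add_self]
  | @cons u v w h p ih =>
    rw [colorWord_support_cons, List.sum_cons, ih, add_assoc, ← add_assoc (c v), Color.add_self,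
      zero_add]

theorem ne_zero_of_mem_colorWord (hc : ∀ u v, G.Adj u v → c u ≠ c v) {u v : V} (p : G.Walk u v) :
    ∀ s ∈ colorWord c p.support, s ≠ 0 := by
  induction p with
  | nil => simp
  | @cons u v w h p ih =>
    rw [colorWord_support_cons]
    intro s hs
    rcases List.mem_cons.1 hs with rfl | hs
    · intro h0
      apply hc u v h
      have := congrArg (· + c v) h0
      simpa [add_assoc, Color.add_self] using this
    · exact ih s hs

end ColorWordValues

/-- There are arbitrarily long reduced words of nonzero letters. -/
theorem exists_reducedWord_length (n : ℕ) :
    ∃ w : ReducedWord Color, w.1.length = n ∧ ∀ s ∈ w.1, s ≠ 0 := by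
  suffices ∀ n, ∃ w : ReducedWord Color, w.1.length = n ∧ (∀ s ∈ w.1, s ≠ 0) ∧
      ∃ s : Color, s ≠ 0 ∧ (s :: w.1).IsChain (· ≠ ·) by
    obtain ⟨w, h1, h2, -⟩ := this n
    exact ⟨w, h1, h2⟩
  intro n
  induction n with
  | zero => exact ⟨ReducedWord.nil, rfl, by simp [ReducedWord.nil], (1, 0), by decide,
      List.isChain_singleton _⟩
  | succ n ih =>
    obtain ⟨w, h1, h2, s, hs, hchain⟩ := ih
    obtain ⟨t, ht0, hts, -⟩ := Color.exists_ne_of_three 0 s s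
    refine ⟨⟨s :: w.1, hchain⟩, by simp [h1], ?_, t, ht0.symm,
      List.isChain_cons_cons.2 ⟨hts.symm, hchain⟩⟩
    intro r hr
    rcases List.mem_cons.1 hr with rfl | hr
    · exact hs
    · exact h2 r hr

/-! ### Coloring the patch extension -/

section Patch

variable {V : Type*} (H : HuedGraph V) (hH : H.UsesHuesZeroOne)
  {E : PlaneEmbedding H.graph} (outer : E.Face)

/-- A coloring of a near-quadrangulation extends to the patch extension if every internal face has
two opposite vertices of the same color. -/
theorem exists_patchExtension_coloring [Finite V]
    (hquad : ∀ p : E.Face, p ≠ outer → p.length = 4) (c : V → Color)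
    (hc : ∀ u v, H.graph.Adj u v → c u ≠ c v)
    (hface : ∀ d : H.graph.Dart, E.faceOf d ≠ outer →
      c d.fst = c (E.facePerm d).snd ∨ c d.snd = c ((E.facePerm ^ 2) d).snd) :
    ∃ β : (patchExtension H hH outer).graph.Coloring Color, ∀ v, β (Sum.inl v) = c v := by
  have hex : ∀ p : {p : E.Face // p ≠ outer}, ∃ e : Color, ∀ v, p.1.HasVertex v → c v ≠ e := by
    rintro ⟨p, hp⟩
    induction p using Quotient.inductionOn with
    | _ d =>
      have hlen : (E.faceOf d).length = 4 := hquad _ hp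
      rcases hface d hp with h | h
      · obtain ⟨e, h1, h2, h3⟩ := Color.exists_ne_of_three (c d.fst) (c d.snd)
          (c ((E.facePerm ^ 2) d).snd)
        refine ⟨e, fun v hv => ?_⟩
        rcases (E.hasVertex_iff_of_length_eq_four hlen v).1 hv with rfl | rfl | rfl | rfl
        · exact h1
        · exact h2
        · rwa [← h]
        · exact h3
      · obtain ⟨e, h1, h2, h3⟩ := Color.exists_ne_of_three (c d.fst) (c d.snd)
          (c (E.facePerm d).snd)
        refine ⟨e, fun v hv => ?_⟩
        rcases (E.hasVertex_iff_of_length_eq_four hlen v).1 hv with rfl | rfl | rfl | rfl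
        · exact h1
        · exact h2
        · exact h3
        · rwa [← h]
  choose e he using hex
  refine ⟨SimpleGraph.Coloring.mk (Sum.elim c e) ?_, fun v => rfl⟩
  rintro (u | p) (v | q) h
  · exact hc u v h
  · exact he q u h
  · exact (he p v h).symm
  · exact h.elim

/-- In a coloring of the patch extension, every internal face has two opposite vertices of the same
color. -/
theorem patchExtension_coloring_face [Finite V]
    (hquad : ∀ p : E.Face, p ≠ outer → p.length = 4)
    (β : (patchExtension H hH outer).graph.Coloring Color) (d : H.graph.Dart)
    (hd : E.faceOf d ≠ outer) :
    β (Sum.inl d.fst) = β (Sum.inl (E.facePerm d).snd) ∨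
      β (Sum.inl d.snd) = β (Sum.inl ((E.facePerm ^ 2) d).snd) := by
  have hlen : (E.faceOf d).length = 4 := hquad _ hd
  obtain ⟨h1, h2, h3, h4⟩ := E.adj_of_length_eq_four hlen
  have hinl : ∀ {u v}, H.graph.Adj u v → β (Sum.inl u) ≠ β (Sum.inl v) := fun {u v} h =>
    β.valid (show (patchExtension H hH outer).graph.Adj (Sum.inl u) (Sum.inl v) from h)
  have hinr : ∀ v, (E.faceOf d).HasVertex v →
      β (Sum.inl v) ≠ β (Sum.inr ⟨E.faceOf d, hd⟩) := fun v h =>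
    β.valid (show (patchExtension H hH outer).graph.Adj (Sum.inl v) (Sum.inr ⟨_, hd⟩) from h)
  have hv := E.hasVertex_iff_of_length_eq_four hlen
  exact Color.eq_or_eq_of_wheel (hinl h1) (hinl h2) (hinl h3) (hinl h4)
    (hinr _ ((hv _).2 (by simp))) (hinr _ ((hv _).2 (by simp)))
    (hinr _ ((hv _).2 (by simp))) (hinr _ ((hv _).2 (by simp)))

end Patch

/-! ### The image of the boundary cycle in the grid -/

section Boundary

variable {V : Type*} (H : HuedGraph V) {S : H.graph.Subgraph}
  {φ : (H.sub S).graph.Coloring Color} (f : ((H.sub S).dapple φ).Hom triangularGrid)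

theorem support_map_hom {u v : S.verts} (p : (H.sub S).graph.Walk u v) :
    (p.map f.toHom).support = p.support.map f.toHom := SimpleGraph.Walk.support_map _ _

theorem colorWord_map_hom {u v : S.verts} (p : (H.sub S).graph.Walk u v) :
    colorWord triangularGrid.color (p.map f.toHom).support = colorWord φ p.support := by
  rw [support_map_hom, colorWord_map]
  congr 1
  funext x
  exact f.color_eq x

theorem colorWord_eq_of_coe {c : V → Color} (hc : ∀ v : S.verts, c v = φ v) {u v : S.verts}
    (p : (H.sub S).graph.Walk u v) :
    colorWord c (p.map S.hom).support = colorWord φ p.support := by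
  rw [SimpleGraph.Walk.support_map, colorWord_map]
  congr 1
  funext x
  exact hc x

theorem hue_mem_of_mem_support_map (hH : H.UsesHuesZeroOne) {u v : S.verts}
    (p : (H.sub S).graph.Walk u v) :
    ∀ x ∈ (p.map f.toHom).support, triangularGrid.hue x = 0 ∨ triangularGrid.hue x = 1 := by
  intro x hx
  rw [support_map_hom, List.mem_map] at hx
  obtain ⟨y, -, rfl⟩ := hx
  have : triangularGrid.hue (f.toHom y) = H.hue y := f.hue_eq y
  rw [this]
  exact hH y

end Boundary

/-! ### The extension criterion -/

theorem mainTheorem5 {V : Type*} [Finite V] (H : HuedGraph V) (hH : H.UsesHuesZeroOne)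
    (E : PlaneEmbedding H.graph) (outer : E.Face)
    (hquad : IsNearQuadrangulation H.graph E outer)
    {c : V} (C : H.graph.Walk c c) (hC : outer.BoundedBy C)
    (φ : (H.sub C.toSubgraph).graph.Coloring Color)
    (hφ : Viable (H.sub C.toSubgraph) φ) :
    (∃ β : (patchExtension H hH outer).graph.Coloring Color,
        ∀ v : C.toSubgraph.verts, β (Sum.inl (v : V)) = φ v) ↔
      NullHomotopicOn H C φ ∧
        ¬ ∃ (u v : C.toSubgraph.verts) (P : H.graph.Walk (u : V) (v : V))
          (B : (H.sub C.toSubgraph).graph.Walk u v), IsShortcut H C φ P B := by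
  classical
  have hcycle : ∀ col : V → Color, (∀ v : C.toSubgraph.verts, col v = φ v) →
      colorWord φ C.mapToSubgraph.support = colorWord col C.support := by
    intro col hcol
    rw [← colorWord_eq_of_coe H hcol]
    exact congrArg (fun p => colorWord col p.support) C.map_mapToSubgraph_hom
  constructor
  · rintro ⟨β, hβ⟩
    let col : V → Color := fun v => β (Sum.inl v)
    obtain ⟨g, hg⟩ := E.exists_potential outer hquad.2 (fun u v => letterPerm (col u + col v))
      (fun u v => by rw [letterPerm_inv, add_comm])
      (fun d hd => letterPerm_four_cycle
        (patchExtension_coloring_face H hH outer hquad.2 β d hd))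
    have hhol : ∀ {u v : V} (p : H.graph.Walk u v), holonomy col p.support = (g u)⁻¹ * g v :=
      fun p => holonomy_eq_of_potential col hg p
    refine ⟨fun f => ?_, ?_⟩
    · refine isNullHomotopic_of_holonomy_eq_one _ (hue_mem_of_mem_support_map H f hH _) ?_
      rw [holonomy, colorWord_map_hom, hcycle col hβ, ← holonomy, hhol, inv_mul_cancel]
    · rintro ⟨u, v, P, B, -, -, f, R, ⟨hR, hirr⟩, hlt⟩
      have hchain := isChain_colorWord_of_irreducible R
        (fun x hx => hue_mem_of_mem_support_map H f hH B x (support_subset_of_reflTransGen hR hx))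
        hirr
      have h1 : holonomy triangularGrid.color R.support = holonomy col P.support := by
        rw [holonomy_eq_of_reflTransGen _ hR, holonomy, colorWord_map_hom,
          ← colorWord_eq_of_coe H (c := col) hβ, ← holonomy, hhol, hhol]
        rfl
      have h2 := wordPerm_apply_nil hchain
      rw [← holonomy, h1] at h2
      have h3 := length_wordPerm_apply_le (colorWord col P.support) ReducedWord.nil
      rw [← holonomy, h2, length_colorWord_support, length_colorWord_support] at h3
      have h4 : (ReducedWord.nil : ReducedWord Color).1.length = 0 := rfl
      omega
  · rintro ⟨hnull, hshort⟩
    obtain ⟨f⟩ := hφ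
    have hconn : H.graph.Connected := E.connected
    -- The coloring `φ`, with a junk value outside of the cycle.
    let col : V → Color := fun v => if h : v ∈ C.toSubgraph.verts then φ ⟨v, h⟩ else 0
    have hcol : ∀ v : C.toSubgraph.verts, col v = φ v := fun v => dif_pos v.2
    obtain ⟨g, hg⟩ := exists_potential_of_isCycle col hC.1 (by
      have := (hnull f).holonomy_eq_one triangularGrid.color
      rwa [holonomy, colorWord_map_hom, hcycle col hcol] at this)
    have hgφ : ∀ u v : C.toSubgraph.verts, (H.sub C.toSubgraph).graph.Adj u v →
        letterPerm (φ u + φ v) = (g u)⁻¹ * g v := by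
      intro u v h
      rw [← hcol, ← hcol]
      exact hg u v h
    -- The base point is lifted so far away from the root that the root plays no role.
    obtain ⟨M, hM⟩ : ∃ M, ∀ u v, H.graph.dist u v ≤ M := by
      obtain ⟨M, hM⟩ := (Set.finite_range fun q : V × V => H.graph.dist q.1 q.2).bddAbove
      exact ⟨M, fun u v => hM ⟨(u, v), rfl⟩⟩
    obtain ⟨x₀, hx₀, hx₀'⟩ := exists_reducedWord_length (M + M)
    -- The lift of `φ` to the tree of reduced words.
    let x : V → ReducedWord Color := fun v => ((g v)⁻¹ * g c) x₀
    have hxc : x c = x₀ := by simp [x]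
    have hxB : ∀ {u v : C.toSubgraph.verts} (B : (H.sub C.toSubgraph).graph.Walk u v),
        x u = wordPerm (colorWord φ B.support) (x v) := by
      intro u v B
      have := holonomy_eq_of_potential φ (g := fun v => g v) hgφ B
      rw [holonomy] at this
      rw [this]
      simp [x]
    have hmem : ∀ {v : V}, v ∈ C.support → v ∈ C.toSubgraph.verts := fun h =>
      C.mem_verts_toSubgraph.2 h
    have hCconn : (H.sub C.toSubgraph).graph.Connected := C.toSubgraph_connected.coe
    let R : V → V → ℕ → Prop := fun u v n =>
      ∃ w : List Color, w.length ≤ n ∧ x u = wordPerm w (x v)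
    have hlip : ∀ u ∈ C.support, ∀ v ∈ C.support, R u v (H.graph.dist u v) := by
      intro u hu v hv
      obtain ⟨P, hP, hlen⟩ := hconn.exists_path_of_dist u v
      rw [← hlen]
      refine forall_path_of_generalizedChord C (R := R) (fun u => ⟨[], le_rfl, rfl⟩)
        (fun u v m n hmn ⟨w, hw, e⟩ => ⟨w, hw.trans hmn, e⟩) ?_ ?_ ?_ hu hv P hP
      · rintro u v z m n ⟨w, hw, e⟩ ⟨w', hw', e'⟩
        refine ⟨w ++ w', ?_, ?_⟩
        · rw [List.length_append]
          omega
        · rw [e, e', wordPerm_append]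
          rfl
      · intro u v huv
        refine ⟨[col u + col v], le_rfl, ?_⟩
        rw [wordPerm_cons, wordPerm_nil, mul_one, hg u v huv]
        simp [x]
      · intro u v hu hv P hchord
        obtain ⟨B, hB⟩ := hCconn.exists_isPath ⟨u, hmem hu⟩ ⟨v, hmem hv⟩
        obtain ⟨Q, hQ⟩ := exists_isTopologicalRetract (B.map f.toHom)
        refine ⟨colorWord triangularGrid.color Q.support, ?_, ?_⟩
        · rw [length_colorWord_support]
          by_contra! hlt
          exact hshort ⟨⟨u, hmem hu⟩, ⟨v, hmem hv⟩, P, B, hchord, hB, f, Q, hQ, hlt⟩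
        · have h1 := hxB B
          rw [← colorWord_map_hom H f, ← holonomy, ← holonomy_eq_of_reflTransGen _ hQ.1] at h1
          exact h1
    let b : V → ZMod 2 := fun v => if H.hue v = 0 then 0 else 1
    have hb : ∀ u v, H.graph.Adj u v → b v = b u + 1 := by
      intro u v huv
      have hne := H.hue.valid huv
      have h10 : (1 : ZMod 3) ≠ 0 := by decide
      have h2 : (1 : ZMod 2) + 1 = 0 := rfl
      rcases hH u with hu | hu <;> rcases hH v with hv | hv
      · exact absurd (hu.trans hv.symm) hne
      · simp [b, hu, hv, h10]
      · simp [b, hu, hv, h10, h2]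
      · exact absurd (hu.trans hv.symm) hne
    have hcsupp : c ∈ C.support := C.start_mem_support
    -- The lift of `u` is obtained from the base point by the word of a walk along the cycle.
    have hword : ∀ u ∈ C.support, ∃ w : List Color, x u = wordPerm w x₀ ∧ (∀ s ∈ w, s ≠ 0) ∧
        w.sum = col u + col c ∧ b u + w.length = b c := by
      intro u hu
      obtain ⟨B⟩ := hCconn ⟨u, hmem hu⟩ ⟨c, hmem hcsupp⟩
      refine ⟨colorWord φ B.support, ?_, ?_, ?_, ?_⟩
      · rw [← hxc]
        exact hxB B
      · exact ne_zero_of_mem_colorWord φ (fun _ _ h => φ.valid h) B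
      · rw [sum_colorWord_support, ← hcol, ← hcol]
      · rw [length_colorWord_support]
        exact (SimpleGraph.Walk.parity_of_alternating (G := (H.sub C.toSubgraph).graph)
          (b := fun v : C.toSubgraph.verts => b v)
          (fun u v h => hb u v (C.toSubgraph.adj_sub h)) B).symm
    obtain ⟨F, hFg, hFsuff, hFadj⟩ := exists_extension_to_tree hconn hb (S := {v | v ∈ C.support})
      ⟨c, hcsupp⟩ (fun v => (x v).1)
      (by
        intro u hu v
        obtain ⟨w, hw, e⟩ := hlip c hcsupp u hu
        have h1 := length_wordPerm_apply_le w (x u)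
        rw [← e, hxc, hx₀] at h1
        have h2 := hM c u
        have h3 := hM u v
        change _ ≤ (x u).1.length
        omega)
      (by
        have : ∀ u ∈ C.support, ((x u).1.length : ZMod 2) + b u = x₀.1.length + b c := by
          intro u hu
          obtain ⟨w, e, -, -, h⟩ := hword u hu
          rw [e, length_wordPerm_apply_cast, ← h]
          ring
        intro u hu v hv
        exact (this u hu).trans (this v hv).symm)
      (by
        intro u hu v hv
        obtain ⟨w, hw, e⟩ := hlip u hu v hv
        obtain ⟨i, j, hi, hj, hij, h⟩ := exists_drop_eq_drop w (x v)
        rw [← e] at hj h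
        exact ⟨j, i, hj, hi, by omega, h.symm⟩)
    have hF0 : ∀ v, ∀ s ∈ F v, s ≠ 0 := by
      intro v s hs
      obtain ⟨u, hu, hsuff⟩ := hFsuff v
      have hs' := hsuff.subset hs
      obtain ⟨w, e, hw, -⟩ := hword u hu
      rw [e] at hs'
      rcases mem_of_mem_wordPerm_apply hs' with h | h
      · exact hw s h
      · exact hx₀' s h
    have hne : ∀ u v s, F u = s :: F v → (F u).sum ≠ (F v).sum := by
      intro u v s h e
      rw [h, List.sum_cons] at e
      exact hF0 u s (by simp [h]) (by simpa using e)
    obtain ⟨β, hβ⟩ := exists_patchExtension_coloring H hH outer hquad.2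
      (fun v => col c + x₀.1.sum + (F v).sum)
      (by
        intro u v huv e
        have e := add_left_cancel e
        rcases hFadj u v huv with ⟨s, hs⟩ | ⟨s, hs⟩
        · exact hne u v s hs e
        · exact hne v u s hs e.symm)
      (by
        intro d hd
        obtain ⟨h1, h2, h3, h4⟩ := E.adj_of_length_eq_four (hquad.2 _ hd)
        exact (eq_or_eq_of_four_walk_in_tree (hFadj _ _ h1) (hFadj _ _ h2) (hFadj _ _ h3)
          (hFadj _ _ h4)).imp (fun h => by rw [h]) (fun h => by rw [h]))
    refine ⟨β, fun v => ?_⟩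
    have hv : (v : V) ∈ C.support := C.mem_verts_toSubgraph.1 v.2
    obtain ⟨w, e, -, hsum, -⟩ := hword v hv
    rw [hβ, hFg v hv, e, sum_wordPerm_apply, hsum, ← hcol]
    have h1 := Color.add_self (col c)
    have h2 := Color.add_self x₀.1.sum
    calc col c + x₀.1.sum + (col v + col c + x₀.1.sum)
        = col v + (col c + col c) + (x₀.1.sum + x₀.1.sum) := by abel
      _ = col v := by rw [h1, h2, add_zero, add_zero]
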